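/- Let $X\subset\mathbb R^m$, $Y\subset\mathbb R^n$ be compact convex sets with diameters at most $D_X$, $D_Y$, and put $D^2=D_X^2+D_Y^2$. Let $\delta,L_{yx},L_{yy},L\ge 0$ and $\mu,\nu>0$. Consider functions $g\colon X\times Y\to\mathbb R$, $h\colon X\times Y\to\mathbb R\cup\{+\infty\}$, $\psi\colon Y\to\mathbb R\cup\{+\infty\}$ and put $\operatorname{dom}\psi=\{y\in Y:\psi(y)<\infty\}$ and $\Pi=\{x\in X:\exists y\in Y,\ h(x,y)<\infty\}$. Assume: 1. $g$ is convex and $\delta$-smooth on $X\times Y$ (differentiable with $\delta$-Lipschitz gradient $\nabla g$); 2. $\psi$ is proper, lower semicontinuous and $\nu$-strongly convex; 3. for every $y\in\operatorname{dom}\psi$, $h(\cdot,y)$ is proper, lower semicontinuous and $\mu$-strongly convex on $X$; 4. $\Pi$ is closed, and for every $x\in\Pi$ the function $h(x,\cdot)$ is finite, concave and continuously differentiable on $Y$; 5. $\|\nabla_y h(x,y)-\nabla_y h(x',y')\|\le L_{yx}\|x-x'\|+L_{yy}\|y-y'\|$ for all $(x,y),(x',y')\in\Pi\times\operatorname{dom}\psi$;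 6. $h$ is $L$-smooth over $\Pi\times\operatorname{dom}\psi$ and $\psi$ is $L$-smooth over $\operatorname{dom}\psi$. In the associated game player 1 maximizes $u_1=-g-h$ over $x\in X$ and player 2 maximizes $u_2=-g+h-\psi$ over $y\in Y$; a Nash equilibrium is a pair $(x^*,y^*)\in\Pi\times\operatorname{dom}\psi$ with $u_1(x^*,y^*)\ge u_1(x,y^*)$ for all $x\in X$ and $u_2(x^*,y^*)\ge u_2(x^*,y)$ for all $y\in Y$. A pair $(\bar x,\bar y)\in X\times Y$ is an $\varepsilon$-accurate Nash equilibrium if $\|\bar x-x^*\|^2+\|\bar y-y^*\|^2\le\varepsilon$ for some Nash equilibrium $(x^*,y^*)$. An algorithm is a deterministic adaptive procedure that knows the numbers $m,n,D_X,D_Y,\delta,\mu,\nu,L_{yx},L_{yy},L,\varepsilon$ and accesses the game only through queries to $\nabla g$ at points of $X\times Y$, to $\nabla_y h$ at points of $\Pi\times Y$, and to the proximal oracles $(\gamma,y,u)\mapsto\operatorname{prox}_{\gamma h(\cdot,y)}(u)$ and $(\gamma,v)\mapsto\operatorname{prox}_{\gamma\psi}(v)$ with $\gamma>0$, $y\in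 Y$. **Theorem.** There is an absolute constant $C>0$ such that for all such parameters and every $\varepsilon>0$ there is an algorithm which, for every game satisfying 1–6, returns an $\varepsilon$-accurate Nash equilibrium, makes in total at most $$C\Bigl(1+\tfrac{\delta}{\min\{\mu,\nu\}}\Bigr)\Bigl(1+\tfrac{L_{yx}}{\sqrt{(\delta+\mu)(\delta+\nu)}}+\tfrac{L_{yy}}{\delta+\nu}\Bigr)\log_+\!\Bigl(\tfrac{LD^2}{\min\{\mu,\nu\}\,\varepsilon}\Bigr)\log_+\!\Bigl(\tfrac{D^2}{\varepsilon}\Bigr)$$ queries to $\nabla_y h$ and to the two proximal oracles, and makes at most $$C\Bigl(1+\tfrac{\delta}{\min\{\mu,\nu\}}\Bigr)\log_+\!\Bigl(\tfrac{D^2}{\varepsilon}\Bigr)$$ queries to $\nabla g$. Here $\log_+ t=\max\{1,\log t\}$ for $t>0$ and $\log_+0=1$. -/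

import Mathlib

/-- The Euclidean space `ℝⁿ` with its Euclidean norm. -/
abbrev Vec (n : ℕ) : Type := EuclideanSpace ℝ (Fin n)

/-- The product `ℝᵐ × ℝⁿ` with the inner product `⟪z', z⟫ = ⟪x', x⟫ + ⟪y', y⟫`. -/
abbrev PairVec (m n : ℕ) : Type := WithLp 2 (Vec m × Vec n)

/-- The pair `(x, y)` as a point of `PairVec m n`. -/
def pairPt {m n : ℕ} (x : Vec m) (y : Vec n) : PairVec m n := WithLp.toLp 2 (x, y)

/-- The product set `A × B` inside `PairVec m n`. -/
def pairSet {m n : ℕ} (A : Set (Vec m)) (B : Set (Vec n)) : Set (PairVec m n) :=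
  {z | z.fst ∈ A ∧ z.snd ∈ B}

/-- The effective domain `{x ∈ S | f x < +∞}` of an extended-real-valued function on `S`. -/
def effDom {E : Type} (S : Set E) (f : E → EReal) : Set E := {x | x ∈ S ∧ f x < ⊤}

/-- `G` is a gradient field of `f` on `S` (derivatives are taken within `S`, so that boundary
points and sets with empty interior are allowed). -/
def IsGradientOn {E : Type} [NormedAddCommGroup E] [InnerProductSpace ℝ E] [CompleteSpace E]
    (S : Set E) (f : E → ℝ) (G : E → E) : Prop :=
  ∀ z ∈ S, HasGradientWithinAt f (G z) S z

/-- `G` is Lipschitz on `S` with constant `L`. -/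
def IsLipschitzFieldOn {E : Type} [NormedAddCommGroup E] (L : ℝ) (S : Set E) (G : E → E) : Prop :=
  ∀ z ∈ S, ∀ z' ∈ S, ‖G z - G z'‖ ≤ L * ‖z - z'‖

/-- `f` is `L`-smooth over `S`: it is differentiable there with `L`-Lipschitz gradient. -/
def IsSmoothOver {E : Type} [NormedAddCommGroup E] [InnerProductSpace ℝ E] [CompleteSpace E]
    (L : ℝ) (S : Set E) (f : E → ℝ) : Prop :=
  ∃ G : E → E, IsGradientOn S f G ∧ IsLipschitzFieldOn L S G

/-- `p = prox_{γ f}(u)`, that is, `p` minimizes `f x + ‖x - u‖² / (2 γ)` over `x ∈ S`, and the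
minimal value is finite. -/
def IsProxPoint {E : Type} [NormedAddCommGroup E] (S : Set E) (f : E → EReal) (γ : ℝ) (u p : E) :
    Prop :=
  p ∈ effDom S f ∧
    ∀ x ∈ S, f p + ((‖p - u‖ ^ 2 / (2 * γ) : ℝ) : EReal)
      ≤ f x + ((‖x - u‖ ^ 2 / (2 * γ) : ℝ) : EReal)

/-- The data of a game. Player 1 chooses `x ∈ X`, player 2 chooses `y ∈ Y`; `gradG` is the gradient
field of the coupling part `g`, and `gradH` is the partial gradient of `h` with respect to `y`. -/
structure CoupledGame (m n : ℕ) where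
  X : Set (Vec m)
  Y : Set (Vec n)
  g : PairVec m n → ℝ
  h : Vec m → Vec n → EReal
  ψ : Vec n → EReal
  gradG : PairVec m n → PairVec m n
  gradH : Vec m → Vec n → Vec n

namespace CoupledGame

variable {m n : ℕ} (G : CoupledGame m n)

/-- `dom ψ`. -/
def domPsi : Set (Vec n) := effDom G.Y G.ψ

/-- The projection of `dom h` to `X`. -/
def projDom : Set (Vec m) := {x | x ∈ G.X ∧ ∃ y ∈ G.Y, G.h x y < ⊤}

/-- Utility of player 1. -/
noncomputable def utility₁ (x : Vec m) (y : Vec n) : EReal := -(G.g (pairPt x y) : EReal) - G.h x y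

/-- Utility of player 2. -/
noncomputable def utility₂ (x : Vec m) (y : Vec n) : EReal :=
  -(G.g (pairPt x y) : EReal) + G.h x y - G.ψ y

/-- Nash equilibria. The strategies have to be feasible (all three functions finite), which rules
out expressions of the form `∞ - ∞` in the utilities compared below. -/
def IsNash (x : Vec m) (y : Vec n) : Prop :=
  x ∈ G.projDom ∧ y ∈ G.domPsi ∧
    (∀ x' ∈ G.X, G.utility₁ x' y ≤ G.utility₁ x y) ∧
    (∀ y' ∈ G.Y, G.utility₂ x y' ≤ G.utility₂ x y)

/-- `ε`-accurate Nash equilibria. -/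
def IsAccurateNash (ε : ℝ) (x : Vec m) (y : Vec n) : Prop :=
  x ∈ G.X ∧ y ∈ G.Y ∧
    ∃ (x' : Vec m) (y' : Vec n), G.IsNash x' y' ∧ ‖x - x'‖ ^ 2 + ‖y - y'‖ ^ 2 ≤ ε

end CoupledGame

/-- The numerical parameters of the problem class. -/
structure GameParams where
  DX : ℝ
  DY : ℝ
  δ : ℝ
  μ : ℝ
  ν : ℝ
  Lyx : ℝ
  Lyy : ℝ
  L : ℝ

/-- The squared diameter bound `D² = D_X² + D_Y²`. -/
def GameParams.Dsq (p : GameParams) : ℝ := p.DX ^ 2 + p.DY ^ 2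

/-- The problem class with parameters `p`. -/
structure CoupledGame.InClass {m n : ℕ} (G : CoupledGame m n) (p : GameParams) : Prop where
  compact_X : IsCompact G.X
  convex_X : Convex ℝ G.X
  diam_X : Metric.diam G.X ≤ p.DX
  compact_Y : IsCompact G.Y
  convex_Y : Convex ℝ G.Y
  diam_Y : Metric.diam G.Y ≤ p.DY
  /- the coupling part is `δ`-smooth and convex -/
  g_convex : ConvexOn ℝ (pairSet G.X G.Y) G.g
  g_grad : IsGradientOn (pairSet G.X G.Y) G.g G.gradG
  g_smooth : IsLipschitzFieldOn p.δ (pairSet G.X G.Y) G.gradG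
  /- `ψ : Y → ℝ ∪ {+∞}` is proper, lower semicontinuous and `ν`-strongly convex -/
  psi_ne_bot : ∀ y ∈ G.Y, G.ψ y ≠ ⊥
  psi_proper : G.domPsi.Nonempty
  psi_lsc : LowerSemicontinuousOn G.ψ G.Y
  psi_strong : StrongConvexOn G.domPsi p.ν (fun y => (G.ψ y).toReal)
  /- for `y ∈ dom ψ`, `h(·, y) : X → ℝ ∪ {+∞}` is proper, lower semicontinuous and `μ`-strongly
  convex -/
  h_ne_bot : ∀ x ∈ G.X, ∀ y ∈ G.Y, G.h x y ≠ ⊥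
  h_proper : ∀ y ∈ G.domPsi, (effDom G.X (fun x => G.h x y)).Nonempty
  h_lsc : ∀ y ∈ G.domPsi, LowerSemicontinuousOn (fun x => G.h x y) G.X
  h_strong : ∀ y ∈ G.domPsi,
    StrongConvexOn (effDom G.X (fun x => G.h x y)) p.μ (fun x => (G.h x y).toReal)
  /- for `x` in the projection of `dom h`, `h(x, ·)` is finite, concave and continuously
  differentiable on `Y`, and the projection is closed -/
  h_dom : ∀ x ∈ G.projDom, effDom G.Y (G.h x) = G.Y
  h_concave : ∀ x ∈ G.projDom, ConcaveOn ℝ G.Y (fun y => (G.h x y).toReal)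
  h_grad : ∀ x ∈ G.projDom, IsGradientOn G.Y (fun y => (G.h x y).toReal) (G.gradH x)
  h_grad_cont : ∀ x ∈ G.projDom, ContinuousOn (G.gradH x) G.Y
  projDom_closed : IsClosed G.projDom
  /- Lipschitz condition on the partial gradient -/
  h_grad_lip : ∀ x ∈ G.projDom, ∀ y ∈ G.domPsi, ∀ x' ∈ G.projDom, ∀ y' ∈ G.domPsi,
    ‖G.gradH x y - G.gradH x' y'‖ ≤ p.Lyx * ‖x - x'‖ + p.Lyy * ‖y - y'‖
  /- `L`-smoothness of `h` over the product of the projection with `dom ψ`, and of `ψ` over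
  `dom ψ` -/
  h_smooth : IsSmoothOver p.L (pairSet G.projDom G.domPsi)
    (fun z => (G.h z.fst z.snd).toReal)
  psi_smooth : IsSmoothOver p.L G.domPsi (fun y => (G.ψ y).toReal)

/-- The four oracles that answer the queries of an algorithm: `∇g`, the partial gradient `∇_y h`,
the proximal operator `(γ, y, u) ↦ prox_{γ h(·, y)}(u)` and `(γ, v) ↦ prox_{γ ψ}(v)`. -/
structure Oracles (m n : ℕ) where
  gradG : PairVec m n → PairVec m n
  gradH : Vec m → Vec n → Vec n
  proxH : ℝ → Vec n → Vec m → Vec m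
  proxPsi : ℝ → Vec n → Vec n

/-- The oracles answer every meaningful query about the game `G` correctly (the answers to all
other queries are arbitrary). -/
structure Oracles.Answer {m n : ℕ} (O : Oracles m n) (G : CoupledGame m n) : Prop where
  gradG_eq : ∀ z ∈ pairSet G.X G.Y, O.gradG z = G.gradG z
  gradH_eq : ∀ x ∈ G.projDom, ∀ y ∈ G.Y, O.gradH x y = G.gradH x y
  proxH_spec : ∀ γ > 0, ∀ y ∈ G.Y, ∀ u : Vec m,
    (∃ q, IsProxPoint G.X (fun x => G.h x y) γ u q) →
      IsProxPoint G.X (fun x => G.h x y) γ u (O.proxH γ y u)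
  proxPsi_spec : ∀ γ > 0, ∀ v : Vec n, IsProxPoint G.Y G.ψ γ v (O.proxPsi γ v)

/-- A deterministic adaptive algorithm with oracle access: it either stops and returns a pair, or
makes a query and continues in dependence on the answer. Along every run it makes finitely many
queries, and it has no access to the game except through the answers. -/
inductive OracleAlgorithm (m n : ℕ) : Type where
  | finish (x : Vec m) (y : Vec n)
  | queryGradG (z : PairVec m n) (next : PairVec m n → OracleAlgorithm m n)
  | queryGradH (x : Vec m) (y : Vec n) (next : Vec n → OracleAlgorithm m n)
  | queryProxH (γ : ℝ) (y : Vec n) (u : Vec m) (next : Vec m → OracleAlgorithm m n)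
  | queryProxPsi (γ : ℝ) (v : Vec n) (next : Vec n → OracleAlgorithm m n)

namespace OracleAlgorithm

variable {m n : ℕ}

/-- The pair returned when the queries are answered by `O`. -/
def output (O : Oracles m n) : OracleAlgorithm m n → Vec m × Vec n
  | finish x y => (x, y)
  | queryGradG z next => output O (next (O.gradG z))
  | queryGradH x y next => output O (next (O.gradH x y))
  | queryProxH γ y u next => output O (next (O.proxH γ y u))
  | queryProxPsi γ v next => output O (next (O.proxPsi γ v))

/-- The number of queries to `∇g`. -/
def numGradG (O : Oracles m n) : OracleAlgorithm m n → ℕ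
  | finish _ _ => 0
  | queryGradG z next => numGradG O (next (O.gradG z)) + 1
  | queryGradH x y next => numGradG O (next (O.gradH x y))
  | queryProxH γ y u next => numGradG O (next (O.proxH γ y u))
  | queryProxPsi γ v next => numGradG O (next (O.proxPsi γ v))

/-- The total number of queries to `∇_y h`, to the proximal oracle of `h` and to the proximal
oracle of `ψ`. -/
def numOther (O : Oracles m n) : OracleAlgorithm m n → ℕ
  | finish _ _ => 0
  | queryGradG z next => numOther O (next (O.gradG z))
  | queryGradH x y next => numOther O (next (O.gradH x y)) + 1
  | queryProxH γ y u next => numOther O (next (O.proxH γ y u)) + 1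
  | queryProxPsi γ v next => numOther O (next (O.proxPsi γ v)) + 1

end OracleAlgorithm

/-!
The equilibria are the solutions of `0 ∈ ∇g z + T z`, where `T` is the saddle operator of the
convex-concave function `h x y - ψ y`; it is strongly monotone with modulus `m = min μ ν`. The
coupling part `g` enters both utilities with the same sign, so `∇g` is the gradient of a convex
function.

*Existence.* Sion's minimax theorem for the bifunction
`φ z' - φ z + h x' y - h x y' + ψ y' - ψ y`, which vanishes on the diagonal, solves
`0 ∈ ∇φ z + T z` for every convex `φ` with a quadratic upper bound
(`IsRegularSaddle.exists_solution`). It is used for `φ = g` and for the regularized inner problems.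

*Outer loop.* A forward-backward step from `z` computes the solution `p` of
`0 ∈ ∇g z + κ (p - z) + T p` with `κ = 4 δ + m`. It contracts the squared distance to the equilibrium
by `κ / (κ + 2 m)`, and a multiple of `κ ‖p - z‖²` is left over. The leftover absorbs an inexact
solution whose squared error, times `κ`, is at most `m ‖p - z‖² / 12`
(`IsSaddleSolution.inexact_forward_backward`), so `O((1 + δ / m) log (D² / ε))` steps suffice.

*Inner loop.* The regularized problem is solved by a primal-dual method with an extrapolated gradient
`∇_y h`, whose rate is governed by the condition number
`Lyx / √((κ + μ) (κ + ν)) + Lyy / (κ + ν)` (`IsRegularSaddle.primalDual_convergence`). Its initial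
energy contains only the proximal weights of the inner steps and not `κ`. After capping `Lyx` and
`Lyy` at `L` these weights are at most `4 L² / m` when `μ, ν ≤ L`, so that the number of inner steps
involves `log (L / m)`, but no `log (δ / m)`. The cap is legitimate because the estimates use
`∇_y h` only in directions within `dom ψ`, where it agrees with the joint gradient of `h`. If a
modulus exceeds `L`, the corresponding domain is a single point and its energy term vanishes.

If `L < m` or `D² ≤ ε`, any feasible point is accurate; otherwise `log (L / m)` is at most
`log (L D² / (m ε))`.
-/

open Set Filter Topology
open scoped RealInnerProductSpace

/-! ### First-order conditions along segments -/

section Segments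

variable {E : Type*} [NormedAddCommGroup E] [InnerProductSpace ℝ E]

lemma nonneg_of_forall_nonneg_add_mul {a b : ℝ} (h : ∀ t : ℝ, 0 < t → t ≤ 1 → 0 ≤ a + t * b) :
    0 ≤ a := by
  have hlim : Tendsto (fun t : ℝ => a + t * b) (𝓝[>] 0) (𝓝 (a + 0 * b)) :=
    ((continuous_const.add (continuous_id.mul continuous_const)).tendsto 0).mono_left
      nhdsWithin_le_nhds
  rw [zero_mul, add_zero] at hlim
  refine ge_of_tendsto hlim ?_
  filter_upwards [Ioc_mem_nhdsGT (zero_lt_one' ℝ)] with t ht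
  exact h t ht.1 ht.2

lemma HasGradientWithinAt.hasDerivWithinAt_segment [CompleteSpace E] {S : Set E} (hS : Convex ℝ S)
    {f : E → ℝ} {a z w : E} (hf : HasGradientWithinAt f a S z) (hz : z ∈ S) (hw : w ∈ S) :
    HasDerivWithinAt (fun t : ℝ => f (z + t • (w - z))) ⟪a, w - z⟫ (Icc 0 1) 0 := by
  have hl : HasDerivWithinAt (fun t : ℝ => z + t • (w - z)) (w - z) (Icc 0 1) 0 := by
    simpa using (((hasDerivAt_id (0 : ℝ)).smul_const (w - z)).const_add z).hasDerivWithinAt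
  have hm : MapsTo (fun t : ℝ => z + t • (w - z)) (Icc 0 1) S :=
    fun t ht => hS.add_smul_sub_mem hz hw ht
  have hf' : HasFDerivWithinAt f (InnerProductSpace.toDual ℝ E a) S (z + (0 : ℝ) • (w - z)) := by
    simpa using hf.hasFDerivWithinAt
  have := hf'.comp_hasDerivWithinAt (0 : ℝ) hl hm
  rwa [InnerProductSpace.toDual_apply_apply] at this

/-- A function of `t ∈ [0, 1]` that lies below its chord by at least `t (1 - t) c` has slope at `0`
at most that of the chord, minus `c`. -/
lemma HasDerivWithinAt.add_le_of_le_chord {φ : ℝ → ℝ} {d c : ℝ}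
    (hφ : HasDerivWithinAt φ d (Icc 0 1) 0)
    (h : ∀ t : ℝ, 0 < t → t ≤ 1 → φ t ≤ (1 - t) * φ 0 + t * φ 1 - t * (1 - t) * c) :
    φ 0 + d + c ≤ φ 1 := by
  have h1 := hasDerivWithinAt_iff_tendsto_slope.1 hφ
  have h2 : Tendsto (fun t : ℝ => φ 1 - φ 0 - (1 - t) * c) (𝓝[Icc 0 1 \ {0}] 0)
      (𝓝 (φ 1 - φ 0 - (1 - 0) * c)) :=
    (Continuous.tendsto (by fun_prop) 0).mono_left nhdsWithin_le_nhds
  have hne : (𝓝[Icc (0 : ℝ) 1 \ {0}] 0).NeBot := by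
    have := uniqueDiffOn_Icc (zero_lt_one' ℝ) 0 ⟨le_rfl, zero_le_one⟩
    exact mem_closure_iff_nhdsWithin_neBot.1 (by
      rw [Icc_sdiff_left, closure_Ioc (by norm_num)]; exact ⟨le_rfl, zero_le_one⟩)
  have h3 : d ≤ φ 1 - φ 0 - (1 - 0) * c := by
    refine le_of_tendsto_of_tendsto h1 h2 ?_
    filter_upwards [self_mem_nhdsWithin] with t ht
    have ht0 : 0 < t := lt_of_le_of_ne ht.1.1 (Ne.symm ht.2)
    rw [slope_def_field, sub_zero, div_le_iff₀ ht0]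
    nlinarith [h t ht0 ht.1.2]
  linarith

/-- The first-order lower bound of a strongly convex function. -/
lemma StrongConvexOn.add_inner_add_le [CompleteSpace E] {S : Set E} {m : ℝ} {f : E → ℝ}
    (hf : StrongConvexOn S m f) {a z w : E} (hg : HasGradientWithinAt f a S z)
    (hz : z ∈ S) (hw : w ∈ S) : f z + ⟪a, w - z⟫ + m / 2 * ‖w - z‖ ^ 2 ≤ f w := by
  have := (hg.hasDerivWithinAt_segment hf.1 hz hw).add_le_of_le_chord
    (c := m / 2 * ‖w - z‖ ^ 2) (fun t ht0 ht1 => by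
      have h := hf.2 hz hw (sub_nonneg.2 ht1) ht0.le (sub_add_cancel 1 t)
      have e : z + t • (w - z) = (1 - t) • z + t • w := by module
      rw [norm_sub_rev] at h
      simp only [smul_eq_mul] at h
      simp only [zero_smul, add_zero, one_smul, add_sub_cancel]
      rw [e]
      linarith)
  simpa using this

lemma ConvexOn.add_inner_le [CompleteSpace E] {S : Set E} {f : E → ℝ}
    (hf : ConvexOn ℝ S f) {a z w : E} (hg : HasGradientWithinAt f a S z)
    (hz : z ∈ S) (hw : w ∈ S) : f z + ⟪a, w - z⟫ ≤ f w := by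
  have := (strongConvexOn_zero.2 hf).add_inner_add_le hg hz hw
  simpa using this

lemma HasGradientWithinAt.fun_neg [CompleteSpace E] {S : Set E} {f : E → ℝ} {a z : E}
    (hg : HasGradientWithinAt f a S z) : HasGradientWithinAt (fun x => -f x) (-a) S z := by
  have := hg.hasFDerivWithinAt.neg
  rwa [← map_neg] at this

lemma ConcaveOn.le_add_inner [CompleteSpace E] {S : Set E} {f : E → ℝ}
    (hf : ConcaveOn ℝ S f) {a z w : E} (hg : HasGradientWithinAt f a S z)
    (hz : z ∈ S) (hw : w ∈ S) : f w ≤ f z + ⟪a, w - z⟫ := by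
  have := hf.neg.add_inner_le (f := fun x => -f x) hg.fun_neg hz hw
  rw [inner_neg_left] at this
  linarith

/-- A gradient within a convex set is determined by the function in the directions that point into
the set. -/
lemma HasGradientWithinAt.inner_eq_of_segment [CompleteSpace E] {S : Set E} (hS : Convex ℝ S)
    {φ : ℝ → ℝ} {d : ℝ}
    {f : E → ℝ} {a z w : E} (hf : HasGradientWithinAt f a S z) (hz : z ∈ S) (hw : w ∈ S)
    (hφ : HasDerivWithinAt φ d (Icc 0 1) 0)
    (h : ∀ t ∈ Icc (0 : ℝ) 1, f (z + t • (w - z)) = φ t) : ⟪a, w - z⟫ = d := by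
  have h1 := hf.hasDerivWithinAt_segment hS hz hw
  have h2 := hφ.congr h (h 0 ⟨le_rfl, zero_le_one⟩)
  exact (uniqueDiffOn_Icc (zero_lt_one' ℝ) 0 ⟨le_rfl, zero_le_one⟩).eq_deriv _ h1 h2

/-- If `p` minimizes `f + q` over `S`, `f` is strongly convex and `q` has a quadratic upper bound at
`p` with slope `a`, then `-a` is a subgradient of `f` at `p`. -/
lemma StrongConvexOn.sub_inner_add_le_of_isMinOn_add {S : Set E} {m : ℝ} {f q : E → ℝ}
    (hf : StrongConvexOn S m f) {p a : E} (hp : p ∈ S) {c : ℝ}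
    (hmin : ∀ x ∈ S, f p + q p ≤ f x + q x)
    (hq : ∀ x ∈ S, q x ≤ q p + ⟪a, x - p⟫ + c * ‖x - p‖ ^ 2) {x : E} (hx : x ∈ S) :
    f p - ⟪a, x - p⟫ + m / 2 * ‖x - p‖ ^ 2 ≤ f x := by
  have key : 0 ≤ f x - f p + ⟪a, x - p⟫ - m / 2 * ‖x - p‖ ^ 2 := by
    refine nonneg_of_forall_nonneg_add_mul (b := (m / 2 + c) * ‖x - p‖ ^ 2) fun t ht0 ht1 => ?_
    have h := hf.2 hp hx (sub_nonneg.2 ht1) ht0.le (sub_add_cancel 1 t)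
    have e : (1 - t) • p + t • x = p + t • (x - p) := by module
    have hmem : p + t • (x - p) ∈ S := hf.1.add_smul_sub_mem hp hx ⟨ht0.le, ht1⟩
    have h1 := hmin _ hmem
    have h2 := hq _ hmem
    rw [e, norm_sub_rev] at h
    simp only [smul_eq_mul] at h
    rw [add_sub_cancel_left, inner_smul_right, norm_smul, Real.norm_of_nonneg ht0.le] at h2
    refine nonneg_of_mul_nonneg_right (a := t) (b := _) ?_ ht0
    nlinarith
  linarith

/-- Variational characterization of the proximal point of a strongly convex function. -/
lemma StrongConvexOn.prox_variational {S : Set E} {m : ℝ} {f : E → ℝ}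
    (hf : StrongConvexOn S m f) {p u : E} {γ : ℝ} (hp : p ∈ S)
    (hmin : ∀ x ∈ S, f p + ‖p - u‖ ^ 2 / (2 * γ) ≤ f x + ‖x - u‖ ^ 2 / (2 * γ)) {x : E}
    (hx : x ∈ S) : f p - ⟪γ⁻¹ • (p - u), x - p⟫ + m / 2 * ‖x - p‖ ^ 2 ≤ f x := by
  refine hf.sub_inner_add_le_of_isMinOn_add (q := fun w => ‖w - u‖ ^ 2 / (2 * γ))
    (c := 1 / (2 * γ)) hp hmin (fun w _ => le_of_eq ?_) hx
  have e : w - u = (p - u) + (w - p) := by abel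
  rw [e, norm_add_sq_real, inner_smul_left]
  by_cases hγ : γ = 0
  · simp [hγ]
  · simp only [conj_trivial]
    field_simp

lemma eq_zero_of_mul_sq_le_mul_sq {m L r : ℝ} (hr : 0 ≤ r) (h : m * r ^ 2 ≤ L * r ^ 2)
    (hL : L < m) : r = 0 := by
  by_contra hne
  have : 0 < r ^ 2 := by positivity
  nlinarith

end Segments

/-! ### Strongly monotone saddle inclusions -/

section Saddle

variable {E F : Type*} [NormedAddCommGroup E] [InnerProductSpace ℝ E]
  [NormedAddCommGroup F] [InnerProductSpace ℝ F]

/-- The convex-concave function `H x y - Ψ y` on `P × Q`, with partial gradient `q` of `H` in `y`,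
is regular: it has strong convexity moduli `μ` and `ν`, and along directions within `Q` the field
`q` is Lipschitz with constants `A` in `x` and `B` in `y`. Only increments of `q` paired with
differences of points of `Q` are controlled, since `Q` may have empty interior. -/
structure IsRegularSaddle (P : Set E) (Q : Set F) (H : E → F → ℝ) (Ψ : F → ℝ) (q : E → F → F)
    (μ ν A B : ℝ) : Prop where
  compact_left : IsCompact P
  compact_right : IsCompact Q
  nonempty_left : P.Nonempty
  nonempty_right : Q.Nonempty
  strong_H : ∀ y ∈ Q, StrongConvexOn P μ (fun x => H x y)
  strong_Psi : StrongConvexOn Q ν Ψ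
  concave_H : ∀ x ∈ P, ConcaveOn ℝ Q (H x)
  continuous_H : ContinuousOn (fun z : E × F => H z.1 z.2) (P ×ˢ Q)
  continuous_Psi : ContinuousOn Ψ Q
  le_add_inner : ∀ x ∈ P, ∀ y ∈ Q, ∀ y' ∈ Q, H x y' ≤ H x y + ⟪q x y, y' - y⟫
  lipschitz : ∀ x ∈ P, ∀ y ∈ Q, ∀ x' ∈ P, ∀ y' ∈ Q, ∀ v ∈ Q, ∀ w ∈ Q,
    ⟪q x y - q x' y', v - w⟫ ≤ (A * ‖x - x'‖ + B * ‖y - y'‖) * ‖v - w‖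

/-- The point `(x, y)` solves the monotone inclusion `0 ∈ T (x, y) + (b, c)`, where `T` is the
saddle operator of `H x y - Ψ y` on `P × Q`. The inclusion is expressed by the variational
inequality it satisfies when `T` is strongly monotone. -/
def IsSaddleSolution (P : Set E) (Q : Set F) (H : E → F → ℝ) (Ψ : F → ℝ) (μ ν : ℝ)
    (x : E) (y : F) (b : E) (c : F) : Prop :=
  x ∈ P ∧ y ∈ Q ∧ ∀ x' ∈ P, ∀ y' ∈ Q,
    μ / 2 * ‖x' - x‖ ^ 2 + ν / 2 * ‖y' - y‖ ^ 2
      ≤ H x' y - H x y' + Ψ y' - Ψ y + ⟪b, x' - x⟫ + ⟪c, y' - y⟫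

variable {P : Set E} {Q : Set F} {H : E → F → ℝ} {Ψ : F → ℝ} {q : E → F → F} {μ ν A B : ℝ}

lemma IsSaddleSolution.strongly_monotone {x x' b b' : E} {y y' c c' : F}
    (h : IsSaddleSolution P Q H Ψ μ ν x y b c) (h' : IsSaddleSolution P Q H Ψ μ ν x' y' b' c') :
    μ * ‖x' - x‖ ^ 2 + ν * ‖y' - y‖ ^ 2 ≤ ⟪b - b', x' - x⟫ + ⟪c - c', y' - y⟫ := by
  have h1 := h.2.2 x' h'.1 y' h'.2.1
  have h2 := h'.2.2 x h.1 y h.2.1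
  rw [norm_sub_rev x x', norm_sub_rev y y', ← neg_sub x' x, ← neg_sub y' y, inner_neg_right,
    inner_neg_right] at h2
  rw [inner_sub_left, inner_sub_left]
  linarith

/-- Sion's theorem, applied to the bifunction
`φ z' - φ z + H x' y - H x y' + Ψ y' - Ψ y` of `z' = (x', y')` and `z = (x, y)`, which vanishes on
the diagonal, gives a solution of the inclusion with perturbation `∇φ`. -/
lemma IsRegularSaddle.exists_solution (hR : IsRegularSaddle P Q H Ψ q μ ν A B)
    (hμ : 0 ≤ μ) (hν : 0 ≤ ν) {φ : E × F → ℝ} {b : E × F → E} {c : E × F → F} {K : ℝ}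
    (hφ : ConvexOn ℝ (P ×ˢ Q) φ) (hφc : ContinuousOn φ (P ×ˢ Q))
    (hup : ∀ z ∈ P ×ˢ Q, ∀ z' ∈ P ×ˢ Q, φ z' ≤ φ z + ⟪b z, z'.1 - z.1⟫ + ⟪c z, z'.2 - z.2⟫
      + K * (‖z'.1 - z.1‖ ^ 2 + ‖z'.2 - z.2‖ ^ 2)) :
    ∃ x y, IsSaddleSolution P Q H Ψ μ ν x y (b (x, y)) (c (x, y)) := by
  have hne : (P ×ˢ Q).Nonempty := hR.nonempty_left.prod hR.nonempty_right
  have hcomp : IsCompact (P ×ˢ Q) := hR.compact_left.prod hR.compact_right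
  have hconv : Convex ℝ (P ×ˢ Q) := hφ.1
  let f : E × F → E × F → ℝ :=
    fun z' z => φ z' - φ z + H z'.1 z.2 - H z.1 z'.2 + Ψ z'.2 - Ψ z.2
  have hfneg : ∀ z z', f z z' = - f z' z := fun z z' => by simp only [f]; ring
  have hHc : ∀ y ∈ Q, ContinuousOn (fun z : E × F => H z.1 y) (P ×ˢ Q) := fun y hy =>
    hR.continuous_H.comp (f := fun z : E × F => (z.1, y)) (by fun_prop) fun z hz => ⟨hz.1, hy⟩
  have hHc' : ∀ x ∈ P, ContinuousOn (fun z : E × F => H x z.2) (P ×ˢ Q) := fun x hx =>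
    hR.continuous_H.comp (f := fun z : E × F => (x, z.2)) (by fun_prop) fun z hz => ⟨hx, hz.2⟩
  have hΨc : ContinuousOn (fun z : E × F => Ψ z.2) (P ×ˢ Q) :=
    hR.continuous_Psi.comp (by fun_prop) fun z hz => hz.2
  have hcl : ∀ z ∈ P ×ˢ Q, ContinuousOn (fun z' => f z' z) (P ×ˢ Q) := fun z hz =>
    ((((hφc.sub continuousOn_const).add (hHc z.2 hz.2)).sub (hHc' z.1 hz.1)).add hΨc).sub
      continuousOn_const
  have hvex : ∀ z ∈ P ×ˢ Q, ConvexOn ℝ (P ×ˢ Q) (fun z' => f z' z) := by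
    refine fun z hz => ⟨hconv, fun u hu v hv s t hs ht hst => ?_⟩
    have h1 := hφ.2 hu hv hs ht hst
    have h2 := ((hR.strong_H z.2 hz.2).convexOn fun r => by positivity).2 hu.1 hv.1 hs ht hst
    have h3 := (hR.concave_H z.1 hz.1).2 hu.2 hv.2 hs ht hst
    have h4 := (hR.strong_Psi.convexOn fun r => by positivity).2 hu.2 hv.2 hs ht hst
    simp only [smul_eq_mul, f, Prod.fst_add, Prod.snd_add, Prod.smul_fst, Prod.smul_snd]
      at h1 h2 h3 h4 ⊢
    obtain rfl : t = 1 - s := by linarith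
    linarith
  obtain ⟨a, ha, d, hd, had⟩ := Sion.exists_isSaddlePointOn (f := f) hne hconv hcomp
    (fun z hz => (hcl z hz).lowerSemicontinuousOn) (fun z hz => (hvex z hz).quasiconvexOn)
    hconv hne hcomp
    (fun z hz => by
      have : (fun z' => f z z') = fun z' => - f z' z := funext fun z' => hfneg z z'
      rw [this]
      exact (hcl z hz).neg.upperSemicontinuousOn)
    (fun z hz => by
      have : (fun z' => f z z') = fun z' => - f z' z := funext fun z' => hfneg z z'
      rw [this]
      exact (hvex z hz).neg.quasiconcaveOn)
  have hgap : ∀ z ∈ P ×ˢ Q, f a z ≤ 0 := fun z hz =>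
    (had d hd z hz).trans (by simp [f])
  obtain ⟨x, y⟩ := a
  refine ⟨x, y, ha.1, ha.2, fun x' hx' y' hy' => ?_⟩
  have h1 : H x y - ⟪b (x, y), x' - x⟫ + μ / 2 * ‖x' - x‖ ^ 2 ≤ H x' y := by
    refine (hR.strong_H y ha.2).sub_inner_add_le_of_isMinOn_add (q := fun w => φ (w, y)) (c := K)
      ha.1 (fun w hw => ?_) (fun w hw => ?_) hx'
    · have := hgap (w, y) ⟨hw, ha.2⟩
      simp only [f] at this
      linarith
    · simpa using hup (x, y) ha (w, y) ⟨hw, ha.2⟩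
  have h2 : Ψ y - H x y - ⟪c (x, y), y' - y⟫ + ν / 2 * ‖y' - y‖ ^ 2 ≤ Ψ y' - H x y' := by
    have hs : StrongConvexOn Q ν (fun w => Ψ w - H x w) := by
      have := UniformConvexOn.sub hR.strong_Psi (uniformConcaveOn_zero.2 (hR.concave_H x ha.1))
      rwa [add_zero] at this
    refine hs.sub_inner_add_le_of_isMinOn_add (q := fun w => φ (x, w)) (c := K)
      ha.2 (fun w hw => ?_) (fun w hw => ?_) hy'
    · have := hgap (x, w) ⟨ha.1, hw⟩
      simp only [f] at this
      linarith
    · simpa using hup (x, y) ha (x, w) ⟨ha.1, hw⟩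
  linarith

end Saddle

/-! ### The inner primal-dual method -/

section InnerLoop

variable {E F : Type*} [NormedAddCommGroup E] [InnerProductSpace ℝ E]
  [NormedAddCommGroup F] [InnerProductSpace ℝ F]
  {P : Set E} {Q : Set F} {H : E → F → ℝ} {Ψ : F → ℝ} {q : E → F → F} {μ ν A B : ℝ}

/-- One step of the primal-dual method for the saddle problem regularized by
`κ / 2 * ‖· - z‖ ^ 2` around `z = (xc, yc)` and tilted by `(b, c)`. The current point `(x, y)` and
its predecessor `(x₀, y₀)` are mapped to `(x₁, y₁)`: first `y₁` by a proximal step with weight `r` and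
an extrapolated gradient, then `x₁` by a proximal step with weight `s`. Both proximal steps enter
through their variational inequalities. -/
structure IsPrimalDualStep (P : Set E) (Q : Set F) (H : E → F → ℝ) (Ψ : F → ℝ) (q : E → F → F)
    (μ ν κ s r θ : ℝ) (xc b : E) (yc c : F) (x₀ : E) (y₀ : F) (x : E) (y : F) (x₁ : E) (y₁ : F) :
    Prop where
  mem_left : x₁ ∈ P
  mem_right : y₁ ∈ Q
  left_le : ∀ w ∈ P, H x₁ y₁ - ⟪b + κ • (x₁ - xc) + s • (x₁ - x), w - x₁⟫
    + μ / 2 * ‖w - x₁‖ ^ 2 ≤ H w y₁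
  right_le : ∀ w ∈ Q, Ψ y₁ - ⟪c + κ • (y₁ - yc) + r • (y₁ - y)
      - (q x y + θ • (q x y - q x₀ y₀)), w - y₁⟫ + ν / 2 * ‖w - y₁‖ ^ 2 ≤ Ψ w

/-- The part of the energy that involves two consecutive points: the error of replacing the gradient
`q x y` by its predecessor, paired with `py - y`, and the squares that dominate this error. -/
noncomputable def lagEnergy (q : E → F → F) (B s : ℝ) (py : F) (x₀ : E) (y₀ : F) (x : E) (y : F) : ℝ :=
  s / 2 * ‖x - x₀‖ ^ 2 + B / 2 * ‖y - y₀‖ ^ 2 - ⟪q x y - q x₀ y₀, py - y⟫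

lemma two_mul_inner_sub_sub {V : Type*} [NormedAddCommGroup V] [InnerProductSpace ℝ V]
    (u v w : V) : 2 * ⟪u - v, u - w⟫ = ‖u - v‖ ^ 2 + ‖u - w‖ ^ 2 - ‖v - w‖ ^ 2 := by
  have e : v - w = (u - w) - (u - v) := by abel
  rw [e, norm_sub_sq_real (u - w) (u - v), real_inner_comm (u - v) (u - w)]
  ring

lemma IsRegularSaddle.inner_le_sq (hR : IsRegularSaddle P Q H Ψ q μ ν A B) {w s : ℝ}
    (hA : 0 ≤ A) (hB : 0 ≤ B) (hw : 0 < w) (hs : s = A * w) {x x₀ : E} {y y₀ u v : F} (hx : x ∈ P)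
    (hx₀ : x₀ ∈ P) (hy : y ∈ Q) (hy₀ : y₀ ∈ Q) (hu : u ∈ Q) (hv : v ∈ Q) :
    ⟪q x y - q x₀ y₀, u - v⟫ ≤ s / 2 * ‖x - x₀‖ ^ 2 + B / 2 * ‖y - y₀‖ ^ 2
      + (A / w + B) / 2 * ‖u - v‖ ^ 2 := by
  refine (hR.lipschitz x hx y hy x₀ hx₀ y₀ hy₀ u hu v hv).trans ?_
  have h1 : A * ‖x - x₀‖ * ‖u - v‖ ≤ A * (w / 2 * ‖x - x₀‖ ^ 2 + 1 / (2 * w) * ‖u - v‖ ^ 2) := by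
    rw [mul_assoc]
    refine mul_le_mul_of_nonneg_left ?_ hA
    have : w / 2 * ‖x - x₀‖ ^ 2 + 1 / (2 * w) * ‖u - v‖ ^ 2 - ‖x - x₀‖ * ‖u - v‖
        = (w * ‖x - x₀‖ - ‖u - v‖) ^ 2 / (2 * w) := by field_simp; ring
    have h0 : 0 ≤ (w * ‖x - x₀‖ - ‖u - v‖) ^ 2 / (2 * w) := by positivity
    linarith
  have h2 : B * (‖y - y₀‖ * ‖u - v‖) ≤ B * (‖y - y₀‖ ^ 2 / 2 + ‖u - v‖ ^ 2 / 2) :=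
    mul_le_mul_of_nonneg_left (by nlinarith [sq_nonneg (‖y - y₀‖ - ‖u - v‖)]) hB
  have e : (A / w + B) / 2 * ‖u - v‖ ^ 2 = A * (1 / (2 * w) * ‖u - v‖ ^ 2) + B * (‖u - v‖ ^ 2 / 2) := by
    field_simp
  rw [e, hs]
  linarith

lemma IsPrimalDualStep.inner_estimate (hR : IsRegularSaddle P Q H Ψ q μ ν A B)
    {κ s r θ : ℝ} {xc b px x₀ x x₁ : E} {yc c py y₀ y y₁ : F}
    (hp : IsSaddleSolution P Q H Ψ μ ν px py (b + κ • (px - xc)) (c + κ • (py - yc)))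
    (h : IsPrimalDualStep P Q H Ψ q μ ν κ s r θ xc b yc c x₀ y₀ x y x₁ y₁) :
    (κ + μ) * ‖x₁ - px‖ ^ 2 + (κ + ν) * ‖y₁ - py‖ ^ 2
      + s / 2 * (‖x₁ - x‖ ^ 2 + ‖x₁ - px‖ ^ 2 - ‖x - px‖ ^ 2)
      + r / 2 * (‖y₁ - y‖ ^ 2 + ‖y₁ - py‖ ^ 2 - ‖y - py‖ ^ 2)
      ≤ ⟪q x₁ y₁ - q x y - θ • (q x y - q x₀ y₀), py - y₁⟫ := by
  have hX := h.left_le px hp.1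
  have hY := h.right_le py hp.2.1
  have hC := hR.le_add_inner x₁ h.mem_left y₁ h.mem_right py hp.2.1
  have hP := hp.2.2 x₁ h.mem_left y₁ h.mem_right
  have e1 := two_mul_inner_sub_sub x₁ x px
  have e2 := two_mul_inner_sub_sub y₁ y py
  have n1 : ⟪x₁ - px, x₁ - px⟫ = ‖x₁ - px‖ ^ 2 := real_inner_self_eq_norm_sq _
  have n2 : ⟪y₁ - py, y₁ - py⟫ = ‖y₁ - py‖ ^ 2 := real_inner_self_eq_norm_sq _
  have s1 : x₁ - xc = (x₁ - px) + (px - xc) := by abel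
  have s2 : y₁ - yc = (y₁ - py) + (py - yc) := by abel
  rw [s1, ← neg_sub x₁ px, norm_neg] at hX
  rw [s2, ← neg_sub y₁ py, norm_neg] at hY
  rw [← neg_sub y₁ py] at hC ⊢
  simp only [inner_add_left, inner_sub_left, inner_neg_right, real_inner_smul_left, smul_add] at *
  linear_combination hX + hY + hC + hP - s / 2 * e1 - r / 2 * e2 - κ * n1 - κ * n2

/-- The energy estimate for one primal-dual step: the term `θ • lagEnergy` pays for the
extrapolation, and the new `lagEnergy` is gained together with the strong convexity terms. -/
lemma IsPrimalDualStep.energy_le (hR : IsRegularSaddle P Q H Ψ q μ ν A B)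
    (hA : 0 ≤ A) (hB : 0 ≤ B) {κ s r θ w : ℝ} (hw : 0 < w) (hs : s = A * w)
    (hr : A / w + 2 * B ≤ r) (hθ : 0 ≤ θ) (hθ1 : θ ≤ 1)
    {xc b px x₀ x x₁ : E} {yc c py y₀ y y₁ : F}
    (hx₀ : x₀ ∈ P) (hy₀ : y₀ ∈ Q) (hx : x ∈ P) (hy : y ∈ Q)
    (hp : IsSaddleSolution P Q H Ψ μ ν px py (b + κ • (px - xc)) (c + κ • (py - yc)))
    (h : IsPrimalDualStep P Q H Ψ q μ ν κ s r θ xc b yc c x₀ y₀ x y x₁ y₁) :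
    (s / 2 + (κ + μ)) * ‖x₁ - px‖ ^ 2 + (r / 2 + (κ + ν)) * ‖y₁ - py‖ ^ 2
        + lagEnergy q B s py x y x₁ y₁
      ≤ s / 2 * ‖x - px‖ ^ 2 + r / 2 * ‖y - py‖ ^ 2 + θ * lagEnergy q B s py x₀ y₀ x y := by
  have h1 := h.inner_estimate hR hp
  have h2 := hR.inner_le_sq hA hB hw hs hx hx₀ hy hy₀ h.mem_right hy
  have hAw : 0 ≤ A / w := by positivity
  have h3 : θ * ⟪q x y - q x₀ y₀, y₁ - y⟫ ≤ θ * (s / 2 * ‖x - x₀‖ ^ 2 + B / 2 * ‖y - y₀‖ ^ 2)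
      + (A / w + B) / 2 * ‖y₁ - y‖ ^ 2 := by
    have h4 := mul_le_mul_of_nonneg_left h2 hθ
    have h5 : θ * ((A / w + B) / 2 * ‖y₁ - y‖ ^ 2) ≤ 1 * ((A / w + B) / 2 * ‖y₁ - y‖ ^ 2) :=
      mul_le_mul_of_nonneg_right hθ1 (by positivity)
    linarith
  have e : py - y₁ = (py - y) - (y₁ - y) := by abel
  rw [inner_sub_left, real_inner_smul_left] at h1
  nth_rewrite 2 [e] at h1
  rw [inner_sub_right (q x y - q x₀ y₀)] at h1
  have h6 : (A / w + 2 * B) * ‖y₁ - y‖ ^ 2 ≤ r * ‖y₁ - y‖ ^ 2 := by gcongr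
  unfold lagEnergy
  linarith

lemma IsRegularSaddle.lagEnergy_ge (hR : IsRegularSaddle P Q H Ψ q μ ν A B)
    (hA : 0 ≤ A) (hB : 0 ≤ B) {s r w : ℝ} (hw : 0 < w) (hs : s = A * w)
    (hr : A / w + 2 * B ≤ r) {x x₀ : E} {y y₀ py : F} (hx₀ : x₀ ∈ P) (hy₀ : y₀ ∈ Q)
    (hx : x ∈ P) (hy : y ∈ Q) (hpy : py ∈ Q) :
    -(r / 2 * ‖y - py‖ ^ 2) ≤ lagEnergy q B s py x₀ y₀ x y := by
  have h2 := hR.inner_le_sq hA hB hw hs hx hx₀ hy hy₀ hpy hy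
  rw [norm_sub_rev py y] at h2
  have h6 : (A / w + B) * ‖y - py‖ ^ 2 ≤ r * ‖y - py‖ ^ 2 := by gcongr; linarith
  unfold lagEnergy
  linarith

/-- Linear convergence of the primal-dual method to the solution `(px, py)` of the regularized
problem. The initial error enters through the weights `s` and `r` of the proximal steps only; it does
not involve `κ`. -/
theorem IsRegularSaddle.primalDual_convergence (hR : IsRegularSaddle P Q H Ψ q μ ν A B)
    (hA : 0 ≤ A) (hB : 0 ≤ B) (hμ : 0 ≤ μ) (hν : 0 ≤ ν) {κ s r θ w : ℝ}
    (hw : 0 < w) (hs : s = A * w) (hr : A / w + 2 * B ≤ r) (hθ : 0 ≤ θ) (hθ1 : θ ≤ 1)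
    (hsθ : s ≤ θ * (s + 2 * (κ + μ))) (hrθ : r ≤ θ * (r + 2 * (κ + ν)))
    {xc b px : E} {yc c py : F} (hxc : xc ∈ P) (hyc : yc ∈ Q)
    (hp : IsSaddleSolution P Q H Ψ μ ν px py (b + κ • (px - xc)) (c + κ • (py - yc)))
    (z : ℕ → (E × F) × (E × F)) (hz0 : z 0 = ((xc, yc), (xc, yc)))
    (hz : ∀ t, (z t).1.1 ∈ P → (z t).1.2 ∈ Q → (z (t + 1)).2 = (z t).1 ∧
      IsPrimalDualStep P Q H Ψ q μ ν κ s r θ xc b yc c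
      (z t).2.1 (z t).2.2 (z t).1.1 (z t).1.2 (z (t + 1)).1.1 (z (t + 1)).1.2) (k : ℕ) :
    (z (k + 1)).1.1 ∈ P ∧ (z (k + 1)).1.2 ∈ Q ∧
    κ * (‖(z (k + 1)).1.1 - px‖ ^ 2 + ‖(z (k + 1)).1.2 - py‖ ^ 2)
      ≤ θ ^ k * (s / 2 * ‖xc - px‖ ^ 2 + r / 2 * ‖yc - py‖ ^ 2) := by
  have hmem : ∀ t, ((z t).1.1 ∈ P ∧ (z t).1.2 ∈ Q) ∧ ((z t).2.1 ∈ P ∧ (z t).2.2 ∈ Q) := by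
    intro t
    induction t with
    | zero => rw [hz0]; exact ⟨⟨hxc, hyc⟩, hxc, hyc⟩
    | succ t ih =>
      obtain ⟨h1, h2⟩ := hz t ih.1.1 ih.1.2
      rw [h1]
      exact ⟨⟨h2.mem_left, h2.mem_right⟩, ih.1⟩
  have hstep : ∀ t, (s / 2 + (κ + μ)) * ‖(z (t + 1)).1.1 - px‖ ^ 2
        + (r / 2 + (κ + ν)) * ‖(z (t + 1)).1.2 - py‖ ^ 2
        + lagEnergy q B s py (z t).1.1 (z t).1.2 (z (t + 1)).1.1 (z (t + 1)).1.2
      ≤ s / 2 * ‖(z t).1.1 - px‖ ^ 2 + r / 2 * ‖(z t).1.2 - py‖ ^ 2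
        + θ * lagEnergy q B s py (z t).2.1 (z t).2.2 (z t).1.1 (z t).1.2 := fun t =>
    (hz t (hmem t).1.1 (hmem t).1.2).2.energy_le hR hA hB hw hs hr hθ hθ1 (hmem t).2.1 (hmem t).2.2
      (hmem t).1.1 (hmem t).1.2 hp
  have hdecay : ∀ t, s / 2 * ‖(z t).1.1 - px‖ ^ 2 + r / 2 * ‖(z t).1.2 - py‖ ^ 2
        + θ * lagEnergy q B s py (z t).2.1 (z t).2.2 (z t).1.1 (z t).1.2
      ≤ θ ^ t * (s / 2 * ‖xc - px‖ ^ 2 + r / 2 * ‖yc - py‖ ^ 2) := by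
    intro t
    induction t with
    | zero => rw [hz0]; simp [lagEnergy]
    | succ t ih =>
      have h1 := mul_le_mul_of_nonneg_left ((hstep t).trans ih) hθ
      rw [(hz t (hmem t).1.1 (hmem t).1.2).1]
      have h2 := mul_le_mul_of_nonneg_right hsθ (sq_nonneg ‖(z (t + 1)).1.1 - px‖)
      have h3 := mul_le_mul_of_nonneg_right hrθ (sq_nonneg ‖(z (t + 1)).1.2 - py‖)
      rw [pow_succ θ t]
      linarith
  refine ⟨(hmem _).1.1, (hmem _).1.2, ?_⟩
  have h1 := (hstep k).trans (hdecay k)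
  have h2 := hR.lagEnergy_ge hA hB hw hs hr (hmem k).1.1 (hmem k).1.2 (hmem (k + 1)).1.1
    (hmem (k + 1)).1.2 hp.2.1
  have h3 : 0 ≤ s / 2 * ‖(z (k + 1)).1.1 - px‖ ^ 2 := by rw [hs]; positivity
  have h4 := mul_nonneg hμ (sq_nonneg ‖(z (k + 1)).1.1 - px‖)
  have h5 := mul_nonneg hν (sq_nonneg ‖(z (k + 1)).1.2 - py‖)
  linarith

end InnerLoop

/-! ### The outer forward-backward iteration -/

section OuterLoop

variable {E F : Type*} [NormedAddCommGroup E] [InnerProductSpace ℝ E]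
  [NormedAddCommGroup F] [InnerProductSpace ℝ F]
  {P : Set E} {Q : Set F} {H : E → F → ℝ} {Ψ : F → ℝ} {μ ν : ℝ}

lemma norm_add_sq_le_of_mul_eq_one {V : Type*} [NormedAddCommGroup V] [InnerProductSpace ℝ V]
    {η ζ : ℝ} (hη : 0 < η) (h : η * ζ = 1) (u v : V) :
    ‖u + v‖ ^ 2 ≤ (1 + η) * ‖u‖ ^ 2 + (1 + ζ) * ‖v‖ ^ 2 := by
  have h1 := norm_add_le u v
  have h2 : ‖u + v‖ ^ 2 ≤ (‖u‖ + ‖v‖) ^ 2 := by gcongr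
  have hζ : ζ = 1 / η := by field_simp; linarith
  have h3 : η * ‖u‖ ^ 2 + ζ * ‖v‖ ^ 2 - 2 * (‖u‖ * ‖v‖) = (η * ‖u‖ - ‖v‖) ^ 2 / η := by
    rw [hζ]; field_simp; ring
  have h4 : 0 ≤ (η * ‖u‖ - ‖v‖) ^ 2 / η := by positivity
  linarith

/-- The exact forward-backward step: `(px, py)` is its result when started at `(xc, yc)`, and
`(xs, ys)` is an equilibrium. -/
lemma IsSaddleSolution.forward_backward {κ δ m : ℝ} (hmμ : m ≤ μ) (hmν : m ≤ ν)
    {xs bs px b xc : E} {ys cs py c yc : F} (hsol : IsSaddleSolution P Q H Ψ μ ν xs ys bs cs)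
    (hp : IsSaddleSolution P Q H Ψ μ ν px py (b + κ • (px - xc)) (c + κ • (py - yc)))
    (hg : ⟪bs - b, px - xs⟫ + ⟪cs - c, py - ys⟫ ≤ δ * (‖px - xc‖ ^ 2 + ‖py - yc‖ ^ 2)) :
    (m + κ / 2) * (‖px - xs‖ ^ 2 + ‖py - ys‖ ^ 2)
      + (κ / 2 - δ) * (‖px - xc‖ ^ 2 + ‖py - yc‖ ^ 2)
      ≤ κ / 2 * (‖xc - xs‖ ^ 2 + ‖yc - ys‖ ^ 2) := by
  have h1 := hsol.strongly_monotone hp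
  have e1 := two_mul_inner_sub_sub px xc xs
  have e2 := two_mul_inner_sub_sub py yc ys
  have h2 := mul_le_mul_of_nonneg_right hmμ (sq_nonneg ‖px - xs‖)
  have h3 := mul_le_mul_of_nonneg_right hmν (sq_nonneg ‖py - ys‖)
  have s1 : bs - (b + κ • (px - xc)) = (bs - b) - κ • (px - xc) := by abel
  have s2 : cs - (c + κ • (py - yc)) = (cs - c) - κ • (py - yc) := by abel
  rw [s1, s2, inner_sub_left (bs - b), inner_sub_left (cs - c), real_inner_smul_left,
    real_inner_smul_left] at h1
  linear_combination h1 + h2 + h3 + hg - κ / 2 * e1 - κ / 2 * e2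

/-- An inexact forward-backward step still contracts if its error is controlled by the length of
the exact step: the term `(κ / 2 - δ) * ‖p - zc‖ ^ 2` left over in the exact step absorbs it. -/
lemma IsSaddleSolution.inexact_forward_backward {κ δ m : ℝ} (hδ : 0 ≤ δ) (hm : 0 < m)
    (hmμ : m ≤ μ) (hmν : m ≤ ν) (hκ : κ = 4 * δ + m)
    {xs bs px b xc x₁ : E} {ys cs py c yc y₁ : F}
    (hsol : IsSaddleSolution P Q H Ψ μ ν xs ys bs cs)
    (hp : IsSaddleSolution P Q H Ψ μ ν px py (b + κ • (px - xc)) (c + κ • (py - yc)))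
    (hg : ⟪bs - b, px - xs⟫ + ⟪cs - c, py - ys⟫ ≤ δ * (‖px - xc‖ ^ 2 + ‖py - yc‖ ^ 2))
    (herr : κ * (‖x₁ - px‖ ^ 2 + ‖y₁ - py‖ ^ 2) ≤ m / 12 * (‖xc - px‖ ^ 2 + ‖yc - py‖ ^ 2)) :
    (κ + m) * (‖x₁ - xs‖ ^ 2 + ‖y₁ - ys‖ ^ 2) ≤ κ * (‖xc - xs‖ ^ 2 + ‖yc - ys‖ ^ 2) := by
  have h1 := hsol.forward_backward hmμ hmν hp hg
  rw [norm_sub_rev xc px, norm_sub_rev yc py] at herr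
  have hκm : m ≤ κ := by linarith
  have hκ0 : 0 < κ := by linarith
  -- With `η = m / (κ + m)` the factor `(κ + m) (1 + η)` is exactly `κ + 2 m`.
  have hη : 0 < m / (κ + m) := by positivity
  have hηζ : m / (κ + m) * ((κ + m) / m) = 1 := by field_simp
  have h2 := norm_add_sq_le_of_mul_eq_one hη hηζ (px - xs) (x₁ - px)
  have h3 := norm_add_sq_le_of_mul_eq_one hη hηζ (py - ys) (y₁ - py)
  rw [add_comm (px - xs), sub_add_sub_cancel] at h2
  rw [add_comm (py - ys), sub_add_sub_cancel] at h3
  set U := ‖px - xs‖ ^ 2 + ‖py - ys‖ ^ 2 with hU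
  set V := ‖x₁ - px‖ ^ 2 + ‖y₁ - py‖ ^ 2 with hV
  set W := ‖px - xc‖ ^ 2 + ‖py - yc‖ ^ 2 with hW
  have hV0 : 0 ≤ V := by positivity
  have hW0 : 0 ≤ W := by positivity
  have h4 : ‖x₁ - xs‖ ^ 2 + ‖y₁ - ys‖ ^ 2 ≤ (1 + m / (κ + m)) * U + (1 + (κ + m) / m) * V := by
    rw [hU, hV]; linarith
  have h5 : (κ + m) * ((1 + m / (κ + m)) * U + (1 + (κ + m) / m) * V)
      = (κ + 2 * m) * U + (κ + m) * (κ + 2 * m) / m * V := by field_simp; ring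
  have h6 : (κ + m) * (κ + 2 * m) / m * V ≤ κ / 2 * W := by
    rw [div_mul_eq_mul_div, div_le_iff₀ hm]
    have h7 : (κ + m) * (κ + 2 * m) ≤ 6 * κ * κ := by nlinarith
    nlinarith [mul_le_mul_of_nonneg_right h7 hV0]
  have h8 := mul_le_mul_of_nonneg_left h4 (by positivity : 0 ≤ κ + m)
  have h9 : κ / 4 * W ≤ (κ / 2 - δ) * W := by
    refine mul_le_mul_of_nonneg_right ?_ hW0
    linarith
  rw [h5] at h8
  linarith

end OuterLoop

/-! ### Regularity of a game in the class -/

lemma IsGradientOn.continuousOn {E : Type} [NormedAddCommGroup E] [InnerProductSpace ℝ E]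
    [CompleteSpace E] {S : Set E} {f : E → ℝ} {D : E → E} (h : IsGradientOn S f D) :
    ContinuousOn f S := fun z hz => (h z hz).hasFDerivWithinAt.continuousWithinAt

section PairVec

variable {m n : ℕ}

@[simp] lemma pairPt_fst (x : Vec m) (y : Vec n) : (pairPt x y).fst = x := rfl

@[simp] lemma pairPt_snd (x : Vec m) (y : Vec n) : (pairPt x y).snd = y := rfl

lemma continuous_pairPt : Continuous fun z : Vec m × Vec n => pairPt z.1 z.2 :=
  WithLp.prod_continuous_toLp 2 (Vec m) (Vec n)

lemma inner_pair_sub (a : PairVec m n) (x x' : Vec m) (y y' : Vec n) :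
    ⟪a, pairPt x' y' - pairPt x y⟫ = ⟪a.fst, x' - x⟫ + ⟪a.snd, y' - y⟫ := rfl

lemma norm_pair_sub_sq (x x' : Vec m) (y y' : Vec n) :
    ‖pairPt x' y' - pairPt x y‖ ^ 2 = ‖x' - x‖ ^ 2 + ‖y' - y‖ ^ 2 :=
  WithLp.prod_norm_sq_eq_of_L2 _

lemma convex_pairSet {A : Set (Vec m)} {B : Set (Vec n)} (hA : Convex ℝ A)
    (hB : Convex ℝ B) : Convex ℝ (pairSet A B) := fun _ hu _ hv _ _ ha hb hab =>
  ⟨hA hu.1 hv.1 ha hb hab, hB hu.2 hv.2 ha hb hab⟩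

lemma norm_snd_le_norm (z : PairVec m n) : ‖z.snd‖ ≤ ‖z‖ := by
  have := WithLp.prod_norm_sq_eq_of_L2 z
  exact le_of_sq_le_sq (by nlinarith [sq_nonneg ‖z.fst‖]) (norm_nonneg z)

lemma norm_pair_sub_left (x x' : Vec m) (y : Vec n) :
    ‖pairPt x y - pairPt x' y‖ = ‖x - x'‖ := by
  rw [← sq_eq_sq₀ (norm_nonneg _) (norm_nonneg _), norm_pair_sub_sq]
  simp

lemma norm_pair_sub_right (x : Vec m) (y y' : Vec n) :
    ‖pairPt x y - pairPt x y'‖ = ‖y - y'‖ := by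
  rw [← sq_eq_sq₀ (norm_nonneg _) (norm_nonneg _), norm_pair_sub_sq]
  simp

end PairVec

namespace CoupledGame.InClass

variable {m n : ℕ}

variable {G : CoupledGame m n} {p : GameParams}

lemma projDom_subset : G.projDom ⊆ G.X := fun _ h => h.1

lemma domPsi_subset : G.domPsi ⊆ G.Y := fun _ h => h.1

lemma h_lt_top (hG : G.InClass p) {x : Vec m} {y : Vec n} (hx : x ∈ G.projDom) (hy : y ∈ G.Y) :
    G.h x y < ⊤ := by
  have := hG.h_dom x hx
  rw [← this] at hy
  exact hy.2

lemma coe_toReal_h (hG : G.InClass p) {x : Vec m} {y : Vec n} (hx : x ∈ G.projDom)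
    (hy : y ∈ G.Y) : (((G.h x y).toReal : ℝ) : EReal) = G.h x y :=
  EReal.coe_toReal (hG.h_lt_top hx hy).ne (hG.h_ne_bot x hx.1 y hy)

lemma coe_toReal_psi (hG : G.InClass p) {y : Vec n} (hy : y ∈ G.domPsi) :
    (((G.ψ y).toReal : ℝ) : EReal) = G.ψ y :=
  EReal.coe_toReal hy.2.ne (hG.psi_ne_bot y hy.1)

lemma effDom_h (hG : G.InClass p) {y : Vec n} (hy : y ∈ G.Y) :
    effDom G.X (fun x => G.h x y) = G.projDom := by
  ext x
  exact ⟨fun h => ⟨h.1, y, hy, h.2⟩, fun h => ⟨h.1, hG.h_lt_top h hy⟩⟩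

lemma strongConvexOn_h (hG : G.InClass p) {y : Vec n} (hy : y ∈ G.domPsi) :
    StrongConvexOn G.projDom p.μ (fun x => (G.h x y).toReal) := by
  rw [← hG.effDom_h hy.1]
  exact hG.h_strong y hy

lemma convex_projDom (hG : G.InClass p) : Convex ℝ G.projDom :=
  let ⟨_, hy⟩ := hG.psi_proper
  (hG.strongConvexOn_h hy).1

lemma nonempty_projDom (hG : G.InClass p) : G.projDom.Nonempty := by
  obtain ⟨y, hy⟩ := hG.psi_proper
  rw [← hG.effDom_h hy.1]
  exact hG.h_proper y hy

lemma compact_projDom (hG : G.InClass p) : IsCompact G.projDom :=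
  hG.compact_X.of_isClosed_subset hG.projDom_closed projDom_subset

/-- A smooth convex function is bounded on a bounded set, so the effective domain of `ψ` is a
sublevel set, hence closed by lower semicontinuity. -/
lemma compact_domPsi (hG : G.InClass p) : IsCompact G.domPsi := by
  obtain ⟨y₀, hy₀⟩ := hG.psi_proper
  obtain ⟨D, hD⟩ := hG.psi_smooth
  obtain ⟨R, hR⟩ := hG.compact_Y.isBounded.exists_norm_le
  obtain ⟨M, hM⟩ : ∃ M : ℝ, ∀ v ∈ G.domPsi, (G.ψ v).toReal ≤ M := by
    refine ⟨(G.ψ y₀).toReal + (|p.L| * (R + R) + ‖D y₀‖) * (R + R) + |p.ν| / 2 * (R + R) ^ 2,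
      fun v hv => ?_⟩
    have h1 := hG.psi_strong.add_inner_add_le (hD.1 v hv) hv hy₀
    have hdist : ‖v - y₀‖ ≤ R + R := (norm_sub_le _ _).trans
      (add_le_add (hR v hv.1) (hR y₀ hy₀.1))
    have hR0 : 0 ≤ R + R := (norm_nonneg _).trans hdist
    have h2 : ‖D v‖ ≤ |p.L| * (R + R) + ‖D y₀‖ := by
      have h3 := hD.2 v hv y₀ hy₀
      have h4 : ‖D v‖ ≤ ‖D v - D y₀‖ + ‖D y₀‖ := by
        simpa using norm_add_le (D v - D y₀) (D y₀)
      have h5 : p.L * ‖v - y₀‖ ≤ |p.L| * (R + R) :=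
        mul_le_mul (le_abs_self _) hdist (norm_nonneg _) (abs_nonneg _)
      linarith
    have h6 : -(‖D v‖ * ‖y₀ - v‖) ≤ ⟪D v, y₀ - v⟫ :=
      neg_le_of_abs_le (abs_real_inner_le_norm _ _)
    rw [norm_sub_rev] at h6 h1
    have h7 : ‖D v‖ * ‖v - y₀‖ ≤ (|p.L| * (R + R) + ‖D y₀‖) * (R + R) :=
      mul_le_mul h2 hdist (norm_nonneg _) (by positivity)
    have h8 : -p.ν / 2 * ‖v - y₀‖ ^ 2 ≤ |p.ν| / 2 * (R + R) ^ 2 :=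
      mul_le_mul (by linarith [neg_le_abs p.ν]) (by gcongr) (by positivity) (by positivity)
    linarith
  have heq : G.domPsi = {y | y ∈ G.Y ∧ G.ψ y ≤ (M : EReal)} := by
    ext y
    refine ⟨fun hy => ⟨hy.1, ?_⟩, fun hy => ⟨hy.1, hy.2.trans_lt (EReal.coe_lt_top M)⟩⟩
    rw [← hG.coe_toReal_psi hy]
    exact_mod_cast hM y hy
  obtain ⟨v, hvc, hv⟩ := lowerSemicontinuousOn_iff_preimage_Iic.1 hG.psi_lsc (M : EReal)
  refine hG.compact_Y.of_isClosed_subset ?_ domPsi_subset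
  have : G.domPsi = G.Y ∩ v := by
    rw [heq, ← hv]
    ext y
    simp
  rw [this]
  exact hG.compact_Y.isClosed.inter hvc

lemma continuousOn_h (hG : G.InClass p) :
    ContinuousOn (fun z : Vec m × Vec n => (G.h z.1 z.2).toReal) (G.projDom ×ˢ G.domPsi) := by
  obtain ⟨D, hD⟩ := hG.h_smooth
  have hc : ContinuousOn (fun z : PairVec m n => (G.h z.fst z.snd).toReal)
      (pairSet G.projDom G.domPsi) := hD.1.continuousOn
  have hm : MapsTo (fun z : Vec m × Vec n => pairPt z.1 z.2) (G.projDom ×ˢ G.domPsi)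
      (pairSet G.projDom G.domPsi) := fun z hz => ⟨hz.1, hz.2⟩
  have := hc.comp continuous_pairPt.continuousOn hm
  simpa only [Function.comp_def, pairPt_fst, pairPt_snd] using this

lemma continuousOn_psi (hG : G.InClass p) :
    ContinuousOn (fun y => (G.ψ y).toReal) G.domPsi := by
  obtain ⟨D, hD⟩ := hG.psi_smooth
  exact hD.1.continuousOn

/-- In the directions of `dom ψ`, the partial gradient is as Lipschitz as the joint gradient of
`h`, although the two gradients may differ orthogonally to these directions. -/
lemma inner_gradH_sub_le (hG : G.InClass p) {x x' : Vec m} {y y' v w : Vec n}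
    (hx : x ∈ G.projDom) (hx' : x' ∈ G.projDom) (hy : y ∈ G.domPsi) (hy' : y' ∈ G.domPsi)
    (hv : v ∈ G.domPsi) (hw : w ∈ G.domPsi) :
    ⟪G.gradH x y - G.gradH x' y', v - w⟫ ≤ p.L * ‖pairPt x y - pairPt x' y'‖ * ‖v - w‖ := by
  obtain ⟨D, hD⟩ := hG.h_smooth
  have hconv : Convex ℝ (pairSet G.projDom G.domPsi) :=
    convex_pairSet hG.convex_projDom hG.psi_strong.1
  have h1 : ∀ x ∈ G.projDom, ∀ y ∈ G.domPsi, ∀ v ∈ G.domPsi,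
      ⟪G.gradH x y, v - y⟫ = ⟪(D (pairPt x y)).snd, v - y⟫ := by
    intro x hx y hy v hv
    have h2 := (hD.1 (pairPt x y) ⟨hx, hy⟩).hasDerivWithinAt_segment hconv
      (show pairPt x y ∈ pairSet G.projDom G.domPsi from ⟨hx, hy⟩)
      (show pairPt x v ∈ pairSet G.projDom G.domPsi from ⟨hx, hv⟩)
    rw [inner_pair_sub, sub_self, inner_zero_right, zero_add] at h2
    refine (hG.h_grad x hx y hy.1).inner_eq_of_segment hG.convex_Y hy.1 hv.1 h2 fun t _ => ?_
    simp
  have h3 : ∀ x ∈ G.projDom, ∀ y ∈ G.domPsi,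
      ⟪G.gradH x y, v - w⟫ = ⟪(D (pairPt x y)).snd, v - w⟫ := by
    intro x hx y hy
    have e : v - w = (v - y) - (w - y) := by abel
    rw [e, inner_sub_right _ (v - y), inner_sub_right _ (v - y), h1 x hx y hy v hv,
      h1 x hx y hy w hw]
  rw [inner_sub_left, h3 x hx y hy, h3 x' hx' y' hy', ← inner_sub_left]
  refine (real_inner_le_norm _ _).trans (mul_le_mul_of_nonneg_right ?_ (norm_nonneg _))
  exact (norm_snd_le_norm (D (pairPt x y) - D (pairPt x' y'))).trans
    (hD.2 (pairPt x y) ⟨hx, hy⟩ (pairPt x' y') ⟨hx', hy'⟩)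

/-- Both Lipschitz constants of the partial gradient can be capped at `L`. -/
lemma isRegularSaddle (hG : G.InClass p) :
    IsRegularSaddle G.projDom G.domPsi (fun x y => (G.h x y).toReal) (fun y => (G.ψ y).toReal)
      G.gradH p.μ p.ν (min p.Lyx p.L) (min p.Lyy p.L) where
  compact_left := hG.compact_projDom
  compact_right := hG.compact_domPsi
  nonempty_left := hG.nonempty_projDom
  nonempty_right := hG.psi_proper
  strong_H _ hy := hG.strongConvexOn_h hy
  strong_Psi := hG.psi_strong
  concave_H x hx := (hG.h_concave x hx).subset domPsi_subset hG.psi_strong.1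
  continuous_H := hG.continuousOn_h
  continuous_Psi := hG.continuousOn_psi
  le_add_inner x hx y hy y' hy' :=
    (hG.h_concave x hx).le_add_inner (hG.h_grad x hx y hy.1) hy.1 hy'.1
  lipschitz x hx y hy x' hx' y' hy' v hv w hw := by
    have key : ∀ x ∈ G.projDom, ∀ x' ∈ G.projDom, ∀ y ∈ G.domPsi, ∀ y' ∈ G.domPsi,
        ⟪G.gradH x y - G.gradH x' y', v - w⟫
          ≤ (p.Lyx * ‖x - x'‖ + p.Lyy * ‖y - y'‖) * ‖v - w‖ := by
      intro x hx x' hx' y hy y' hy'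
      exact (real_inner_le_norm _ _).trans
        (mul_le_mul_of_nonneg_right (hG.h_grad_lip x hx y hy x' hx' y' hy') (norm_nonneg _))
    -- Change `x` first and `y` second, with the better of the two bounds for each change.
    have h1 : ⟪G.gradH x y - G.gradH x' y, v - w⟫ ≤ min p.Lyx p.L * ‖x - x'‖ * ‖v - w‖ := by
      rcases min_cases p.Lyx p.L with h | h
      · rw [h.1]
        simpa using key x hx x' hx' y hy y hy
      · rw [h.1, ← norm_pair_sub_left x x' y]
        exact hG.inner_gradH_sub_le hx hx' hy hy hv hw
    have h2 : ⟪G.gradH x' y - G.gradH x' y', v - w⟫ ≤ min p.Lyy p.L * ‖y - y'‖ * ‖v - w‖ := by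
      rcases min_cases p.Lyy p.L with h | h
      · rw [h.1]
        simpa using key x' hx' x' hx' y hy y' hy'
      · rw [h.1, ← norm_pair_sub_right x' y y']
        exact hG.inner_gradH_sub_le hx' hx' hy hy' hv hw
    have e : G.gradH x y - G.gradH x' y'
        = (G.gradH x y - G.gradH x' y) + (G.gradH x' y - G.gradH x' y') := by abel
    rw [e, inner_add_left]
    linarith

/-- A function on a domain with two points cannot have a strong convexity modulus larger than the
Lipschitz constant of its gradient. -/
lemma projDom_subsingleton (hG : G.InClass p) (hL : p.L < p.μ) : G.projDom.Subsingleton := by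
  intro x hx x' hx'
  obtain ⟨y, hy⟩ := hG.psi_proper
  obtain ⟨D, hD⟩ := hG.h_smooth
  have hconv : Convex ℝ (pairSet G.projDom G.domPsi) :=
    convex_pairSet hG.convex_projDom hG.psi_strong.1
  have h1 : ∀ x ∈ G.projDom, ∀ x' ∈ G.projDom, (G.h x y).toReal + ⟪(D (pairPt x y)).fst, x' - x⟫
      + p.μ / 2 * ‖x' - x‖ ^ 2 ≤ (G.h x' y).toReal := by
    intro x hx x' hx'
    have h2 := (hD.1 (pairPt x y) ⟨hx, hy⟩).hasDerivWithinAt_segment hconv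
      (show pairPt x y ∈ pairSet G.projDom G.domPsi from ⟨hx, hy⟩)
      (show pairPt x' y ∈ pairSet G.projDom G.domPsi from ⟨hx', hy⟩)
    rw [inner_pair_sub, sub_self, inner_zero_right, add_zero] at h2
    have h3 := h2.add_le_of_le_chord (c := p.μ / 2 * ‖x' - x‖ ^ 2) fun t ht0 ht1 => by
      have h := (hG.strongConvexOn_h hy).2 hx hx' (sub_nonneg.2 ht1) ht0.le (sub_add_cancel 1 t)
      have e : (1 - t) • x + t • x' = x + t • (x' - x) := by module
      rw [e, norm_sub_rev] at h
      simpa [mul_assoc, mul_left_comm] using h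
    simpa using h3
  have h4 := h1 x hx x' hx'
  have h5 := h1 x' hx' x hx
  have h6 := hD.2 (pairPt x y) ⟨hx, hy⟩ (pairPt x' y) ⟨hx', hy⟩
  have h7 : ⟪D (pairPt x' y) - D (pairPt x y), pairPt x' y - pairPt x y⟫
      ≤ ‖D (pairPt x' y) - D (pairPt x y)‖ * ‖pairPt x' y - pairPt x y‖ := real_inner_le_norm _ _
  rw [inner_pair_sub, sub_self, inner_zero_right, add_zero, WithLp.sub_fst, inner_sub_left,
    norm_pair_sub_left, norm_sub_rev (D _)] at h7
  rw [norm_pair_sub_left, norm_sub_rev x x'] at h6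
  rw [norm_sub_rev x x', ← neg_sub x' x, inner_neg_right] at h5
  have h8 := mul_le_mul_of_nonneg_right h6 (norm_nonneg (x' - x))
  have h9 : ‖x' - x‖ = 0 := eq_zero_of_mul_sq_le_mul_sq (norm_nonneg _) (by nlinarith) hL
  exact (sub_eq_zero.1 (norm_eq_zero.1 h9)).symm

lemma domPsi_subsingleton (hG : G.InClass p) (hL : p.L < p.ν) : G.domPsi.Subsingleton := by
  intro y hy y' hy'
  obtain ⟨D, hD⟩ := hG.psi_smooth
  have h4 := hG.psi_strong.add_inner_add_le (hD.1 y hy) hy hy'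
  have h5 := hG.psi_strong.add_inner_add_le (hD.1 y' hy') hy' hy
  have h6 := hD.2 y hy y' hy'
  have h7 : ⟪D y' - D y, y' - y⟫ ≤ ‖D y' - D y‖ * ‖y' - y‖ := real_inner_le_norm _ _
  rw [inner_sub_left, norm_sub_rev (D _)] at h7
  rw [norm_sub_rev y y'] at h6
  rw [norm_sub_rev y y', ← neg_sub y' y, inner_neg_right] at h5
  have h8 := mul_le_mul_of_nonneg_right h6 (norm_nonneg (y' - y))
  have h9 : ‖y' - y‖ = 0 := eq_zero_of_mul_sq_le_mul_sq (norm_nonneg _) (by nlinarith) hL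
  exact (sub_eq_zero.1 (norm_eq_zero.1 h9)).symm

/-- The quadratic upper bound for the coupling part. Comparing with the tangent at `z'` instead of
integrating along the segment costs a factor `2` in the constant. -/
lemma g_le (hG : G.InClass p) {z z' : PairVec m n} (hz : z ∈ pairSet G.X G.Y)
    (hz' : z' ∈ pairSet G.X G.Y) :
    G.g z' ≤ G.g z + ⟪G.gradG z, z' - z⟫ + p.δ * ‖z' - z‖ ^ 2 := by
  have h1 := hG.g_convex.add_inner_le (hG.g_grad z' hz') hz' hz
  have h2 := real_inner_le_norm (G.gradG z' - G.gradG z) (z' - z)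
  have h3 := mul_le_mul_of_nonneg_right (hG.g_smooth z' hz' z hz) (norm_nonneg (z' - z))
  rw [← neg_sub z' z, inner_neg_right] at h1
  rw [inner_sub_left] at h2
  nlinarith

lemma mem_pairSet {x : Vec m} {y : Vec n} (hx : x ∈ G.projDom) (hy : y ∈ G.domPsi) :
    pairPt x y ∈ pairSet G.X G.Y := ⟨hx.1, hy.1⟩

/-- The gradient inequality for three points that drives the forward-backward step. -/
lemma inner_gradG_le (hG : G.InClass p) {z w s : PairVec m n} (hz : z ∈ pairSet G.X G.Y)
    (hw : w ∈ pairSet G.X G.Y) (hs : s ∈ pairSet G.X G.Y) :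
    ⟪G.gradG s - G.gradG z, w - s⟫ ≤ p.δ * ‖w - z‖ ^ 2 := by
  have h1 := hG.g_convex.add_inner_le (hG.g_grad s hs) hs hw
  have h2 := hG.g_convex.add_inner_le (hG.g_grad z hz) hz hs
  have h3 := hG.g_le hz hw
  have e : w - s = (w - z) - (s - z) := by abel
  have h4 : ⟪G.gradG z, w - s⟫ = ⟪G.gradG z, w - z⟫ - ⟪G.gradG z, s - z⟫ := by
    rw [e, inner_sub_right]
  rw [inner_sub_left]
  linarith

/-- Solutions of the saddle inclusion perturbed by `∇g` are Nash equilibria. -/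
lemma isNash_of_isSaddleSolution (hG : G.InClass p) (hμ : 0 ≤ p.μ) (hν : 0 ≤ p.ν)
    {x : Vec m} {y : Vec n}
    (h : IsSaddleSolution G.projDom G.domPsi (fun x y => (G.h x y).toReal)
      (fun y => (G.ψ y).toReal) p.μ p.ν x y (G.gradG (pairPt x y)).fst
      (G.gradG (pairPt x y)).snd) : G.IsNash x y := by
  obtain ⟨hx, hy, h⟩ := h
  have hz := mem_pairSet hx hy
  refine ⟨hx, hy, fun x' hx' => ?_, fun y' hy' => ?_⟩
  · by_cases hx'' : x' ∈ G.projDom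
    · have h1 := h x' hx'' y hy
      have h2 := hG.g_convex.add_inner_le (hG.g_grad _ hz) hz (mem_pairSet hx'' hy)
      rw [inner_pair_sub] at h2
      have h3 : 0 ≤ p.μ / 2 * ‖x' - x‖ ^ 2 := by positivity
      simp only [sub_self, inner_zero_right, norm_zero] at h1 h2
      unfold CoupledGame.utility₁
      rw [← hG.coe_toReal_h hx hy.1, ← hG.coe_toReal_h hx'' hy.1]
      norm_cast
      linarith
    · have : G.h x' y = ⊤ := by
        by_contra hne
        exact hx'' ⟨hx', y, hy.1, lt_of_le_of_ne le_top hne⟩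
      unfold CoupledGame.utility₁
      rw [this, EReal.sub_top]
      exact bot_le
  · by_cases hy'' : y' ∈ G.domPsi
    · have h1 := h x hx y' hy''
      have h2 := hG.g_convex.add_inner_le (hG.g_grad _ hz) hz (mem_pairSet hx hy'')
      rw [inner_pair_sub] at h2
      have h3 : 0 ≤ p.ν / 2 * ‖y' - y‖ ^ 2 := by positivity
      simp only [sub_self, inner_zero_right, norm_zero] at h1 h2
      unfold CoupledGame.utility₂
      rw [← hG.coe_toReal_h hx hy.1, ← hG.coe_toReal_h hx hy''.1, ← hG.coe_toReal_psi hy,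
        ← hG.coe_toReal_psi hy'']
      norm_cast
      linarith
    · have : G.ψ y' = ⊤ := by
        by_contra hne
        exact hy'' ⟨hy', lt_of_le_of_ne le_top hne⟩
      unfold CoupledGame.utility₂
      rw [this, EReal.sub_top]
      exact bot_le

lemma exists_equilibrium (hG : G.InClass p) (hμ : 0 ≤ p.μ) (hν : 0 ≤ p.ν) :
    ∃ x y, IsSaddleSolution G.projDom G.domPsi (fun x y => (G.h x y).toReal)
      (fun y => (G.ψ y).toReal) p.μ p.ν x y (G.gradG (pairPt x y)).fst
      (G.gradG (pairPt x y)).snd := by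
  refine hG.isRegularSaddle.exists_solution hμ hν (φ := fun z => G.g (pairPt z.1 z.2))
    (b := fun z => (G.gradG (pairPt z.1 z.2)).fst) (c := fun z => (G.gradG (pairPt z.1 z.2)).snd)
    (K := p.δ) ?_ ?_ ?_
  · refine ⟨hG.convex_projDom.prod hG.psi_strong.1, fun u hu v hv a b ha hb hab => ?_⟩
    exact hG.g_convex.2 (mem_pairSet hu.1 hu.2) (mem_pairSet hv.1 hv.2) ha hb hab
  · have hc : ContinuousOn G.g (pairSet G.X G.Y) := hG.g_grad.continuousOn
    have hm : MapsTo (fun z : Vec m × Vec n => pairPt z.1 z.2) (G.projDom ×ˢ G.domPsi)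
        (pairSet G.X G.Y) := fun z hz => mem_pairSet hz.1 hz.2
    have := hc.comp continuous_pairPt.continuousOn hm
    simpa only [Function.comp_def] using this
  · intro z hz z' hz'
    have := hG.g_le (mem_pairSet hz.1 hz.2) (mem_pairSet hz'.1 hz'.2)
    rwa [inner_pair_sub, norm_pair_sub_sq, ← add_assoc] at this

end CoupledGame.InClass

/-- The expansion of a tilted quadratic around `u`. -/
lemma inner_add_sq_expand {V : Type*} [NormedAddCommGroup V] [InnerProductSpace ℝ V]
    (κ : ℝ) (d v u u' : V) :
    ⟪d, u'⟫ + κ / 2 * ‖u' - v‖ ^ 2 = ⟪d, u⟫ + κ / 2 * ‖u - v‖ ^ 2 + ⟪d + κ • (u - v), u' - u⟫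
      + κ / 2 * ‖u' - u‖ ^ 2 := by
  have e : u' - v = (u - v) + (u' - u) := by abel
  rw [e, norm_add_sq_real, inner_add_left, real_inner_smul_left, inner_sub_right d]
  ring

/-- The regularized problem solved by the inner method has a solution. -/
lemma IsRegularSaddle.exists_regularized_solution {E F : Type*} [NormedAddCommGroup E]
    [InnerProductSpace ℝ E] [NormedAddCommGroup F] [InnerProductSpace ℝ F]
    {P : Set E} {Q : Set F} {H : E → F → ℝ} {Ψ : F → ℝ} {q : E → F → F} {μ ν A B : ℝ}
    (hR : IsRegularSaddle P Q H Ψ q μ ν A B) (hμ : 0 ≤ μ) (hν : 0 ≤ ν) {κ : ℝ} (hκ : 0 ≤ κ)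
    (xc b : E) (yc c : F) :
    ∃ px py, IsSaddleSolution P Q H Ψ μ ν px py (b + κ • (px - xc)) (c + κ • (py - yc)) := by
  obtain ⟨y, hy⟩ := hR.nonempty_right
  have hup : ∀ z z' : E × F, (⟪b, z'.1⟫ + κ / 2 * ‖z'.1 - xc‖ ^ 2)
      + (⟪c, z'.2⟫ + κ / 2 * ‖z'.2 - yc‖ ^ 2)
      = (⟪b, z.1⟫ + κ / 2 * ‖z.1 - xc‖ ^ 2) + (⟪c, z.2⟫ + κ / 2 * ‖z.2 - yc‖ ^ 2)
        + ⟪b + κ • (z.1 - xc), z'.1 - z.1⟫ + ⟪c + κ • (z.2 - yc), z'.2 - z.2⟫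
        + κ / 2 * (‖z'.1 - z.1‖ ^ 2 + ‖z'.2 - z.2‖ ^ 2) := by
    intro z z'
    rw [inner_add_sq_expand κ b xc z.1 z'.1, inner_add_sq_expand κ c yc z.2 z'.2]
    ring
  have hconv : Convex ℝ (P ×ˢ Q) := (hR.strong_H y hy).1.prod hR.strong_Psi.1
  refine hR.exists_solution hμ hν
    (φ := fun z => (⟪b, z.1⟫ + κ / 2 * ‖z.1 - xc‖ ^ 2) + (⟪c, z.2⟫ + κ / 2 * ‖z.2 - yc‖ ^ 2))
    (b := fun z => b + κ • (z.1 - xc)) (c := fun z => c + κ • (z.2 - yc)) (K := κ / 2)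
    ⟨hconv, fun u _ v _ s t hs ht hst => ?_⟩ (by fun_prop) fun z _ z' _ => (hup z z').le
  set w := s • u + t • v with hw
  have hu := hup w u
  have hv := hup w v
  have h1 : s • (u.1 - w.1) + t • (v.1 - w.1) = 0 := by
    obtain rfl : t = 1 - s := by linarith
    rw [hw]; simp only [Prod.fst_add, Prod.smul_fst]; module
  have h2 : s • (u.2 - w.2) + t • (v.2 - w.2) = 0 := by
    obtain rfl : t = 1 - s := by linarith
    rw [hw]; simp only [Prod.snd_add, Prod.smul_snd]; module
  have h3 := congrArg (fun d => ⟪b + κ • (w.1 - xc), d⟫) h1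
  have h4 := congrArg (fun d => ⟪c + κ • (w.2 - yc), d⟫) h2
  simp only [inner_add_right, real_inner_smul_right, inner_zero_right] at h3 h4
  simp only [smul_eq_mul]
  have h5 : 0 ≤ s * (κ / 2 * (‖u.1 - w.1‖ ^ 2 + ‖u.2 - w.2‖ ^ 2)) := by positivity
  have h6 : 0 ≤ t * (κ / 2 * (‖v.1 - w.1‖ ^ 2 + ‖v.2 - w.2‖ ^ 2)) := by positivity
  rw [hu, hv]
  obtain rfl : t = 1 - s := by linarith
  linarith

/-! ### The algorithm -/

/-- The weights of the sliding algorithm: `κ` is the weight of the outer proximal term, `s` and `r`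
are the weights of the inner proximal terms in `x` and `y`, and `θ` is the extrapolation factor. -/
structure SlidingWeights where
  κ : ℝ
  s : ℝ
  r : ℝ
  θ : ℝ

namespace OracleAlgorithm

variable {m n : ℕ}

/-- `N` steps of the inner primal-dual method around the center `(xc, yc)` with the coupling gradient
`a`, started at the pair `z` of the current point and its predecessor, then continued by `next`. -/
noncomputable def innerLoop (W : SlidingWeights) (a : PairVec m n) (xc : Vec m) (yc : Vec n)
    (next : Vec m × Vec n → OracleAlgorithm m n) :
    ℕ → (Vec m × Vec n) × (Vec m × Vec n) → OracleAlgorithm m n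
  | 0, z => next z.1
  | N + 1, z =>
    queryGradH z.1.1 z.1.2 fun q => queryGradH z.2.1 z.2.2 fun q₀ =>
      queryProxPsi (W.κ + W.r)⁻¹
        ((W.κ + W.r)⁻¹ • (W.κ • yc + W.r • z.1.2 - a.snd + (q + W.θ • (q - q₀)))) fun y =>
      queryProxH (W.κ + W.s)⁻¹ y ((W.κ + W.s)⁻¹ • (W.κ • xc + W.s • z.1.1 - a.fst)) fun x =>
      innerLoop W a xc yc next N ((x, y), z.1)

/-- The result of one inner step when the queries are answered by `O`. -/
noncomputable def innerStep (O : Oracles m n) (W : SlidingWeights) (a : PairVec m n) (xc : Vec m)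
    (yc : Vec n) (z : (Vec m × Vec n) × (Vec m × Vec n)) : (Vec m × Vec n) × (Vec m × Vec n) :=
  let y := O.proxPsi (W.κ + W.r)⁻¹ ((W.κ + W.r)⁻¹ • (W.κ • yc + W.r • z.1.2 - a.snd
    + (O.gradH z.1.1 z.1.2 + W.θ • (O.gradH z.1.1 z.1.2 - O.gradH z.2.1 z.2.2))))
  let x := O.proxH (W.κ + W.s)⁻¹ y ((W.κ + W.s)⁻¹ • (W.κ • xc + W.s • z.1.1 - a.fst))
  ((x, y), z.1)

/-- `K` outer steps, each with one query to `∇g` and `N` inner steps. -/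
noncomputable def outerLoop (W : SlidingWeights) (N : ℕ) : ℕ → Vec m × Vec n → OracleAlgorithm m n
  | 0, z => finish z.1 z.2
  | K + 1, z => queryGradG (pairPt z.1 z.2) fun a =>
      innerLoop W a z.1 z.2 (outerLoop W N K) N (z, z)

/-- The result of one outer step when the queries are answered by `O`. -/
noncomputable def outerStep (O : Oracles m n) (W : SlidingWeights) (N : ℕ) (z : Vec m × Vec n) :
    Vec m × Vec n :=
  ((innerStep O W (O.gradG (pairPt z.1 z.2)) z.1 z.2)^[N] (z, z)).1

/-- The computation of a feasible point by one proximal step each for `ψ` and `h`, continued by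
`next`. -/
def startFeasible (next : Vec m × Vec n → OracleAlgorithm m n) : OracleAlgorithm m n :=
  queryProxPsi 1 0 fun y => queryProxH 1 y 0 fun x => next (x, y)

/-- The feasible point computed by `startFeasible`. -/
def initialPoint (O : Oracles m n) : Vec m × Vec n := (O.proxH 1 (O.proxPsi 1 0) 0, O.proxPsi 1 0)

variable (O : Oracles m n) (W : SlidingWeights)

lemma innerLoop_run (a : PairVec m n) (xc : Vec m) (yc : Vec n)
    (next : Vec m × Vec n → OracleAlgorithm m n) (N : ℕ) (z : (Vec m × Vec n) × (Vec m × Vec n)) :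
    (innerLoop W a xc yc next N z).output O
        = (next ((innerStep O W a xc yc)^[N] z).1).output O ∧
      (innerLoop W a xc yc next N z).numOther O
        = (next ((innerStep O W a xc yc)^[N] z).1).numOther O + 4 * N ∧
      (innerLoop W a xc yc next N z).numGradG O
        = (next ((innerStep O W a xc yc)^[N] z).1).numGradG O := by
  induction N generalizing z with
  | zero => exact ⟨rfl, rfl, rfl⟩
  | succ N ih =>
    obtain ⟨h1, h2, h3⟩ := ih (innerStep O W a xc yc z)
    rw [Function.iterate_succ_apply]
    refine ⟨h1, ?_, h3⟩
    have : (innerLoop W a xc yc next (N + 1) z).numOther O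
        = (innerLoop W a xc yc next N (innerStep O W a xc yc z)).numOther O + 1 + 1 + 1 + 1 := rfl
    rw [this, h2]
    ring

lemma outerLoop_run (N K : ℕ) (z : Vec m × Vec n) :
    (outerLoop W N K z).output O = (outerStep O W N)^[K] z ∧
      (outerLoop W N K z).numOther O = 4 * N * K ∧
      (outerLoop W N K z).numGradG O = K := by
  induction K generalizing z with
  | zero => exact ⟨rfl, rfl, rfl⟩
  | succ K ih =>
    obtain ⟨h1, h2, h3⟩ := ih (outerStep O W N z)
    obtain ⟨g1, g2, g3⟩ := innerLoop_run O W (O.gradG (pairPt z.1 z.2)) z.1 z.2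
      (outerLoop W N K) N (z, z)
    rw [Function.iterate_succ_apply]
    refine ⟨g1.trans h1, ?_, ?_⟩
    · refine (g2.trans (congrArg (· + 4 * N) h2)).trans ?_
      ring
    · exact congrArg (· + 1) (g3.trans h3)

end OracleAlgorithm

/-! ### Correctness of the steps of the algorithm -/

namespace CoupledGame.InClass

variable {m n : ℕ} {G : CoupledGame m n} {p : GameParams} {O : Oracles m n}

lemma proxPsi_mem (hO : O.Answer G) {γ : ℝ} (hγ : 0 < γ) (v : Vec n) :
    O.proxPsi γ v ∈ G.domPsi := (hO.proxPsi_spec γ hγ v).1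

lemma proxPsi_variational (hG : G.InClass p) (hO : O.Answer G) {γ : ℝ} (hγ : 0 < γ) (v : Vec n)
    {w : Vec n} (hw : w ∈ G.domPsi) :
    (G.ψ (O.proxPsi γ v)).toReal - ⟪γ⁻¹ • (O.proxPsi γ v - v), w - O.proxPsi γ v⟫
      + p.ν / 2 * ‖w - O.proxPsi γ v‖ ^ 2 ≤ (G.ψ w).toReal := by
  refine hG.psi_strong.prox_variational (proxPsi_mem hO hγ v) (fun x hx => ?_) hw
  have := (hO.proxPsi_spec γ hγ v).2 x hx.1
  rw [← hG.coe_toReal_psi hx, ← hG.coe_toReal_psi (proxPsi_mem hO hγ v)] at this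
  exact_mod_cast this

/-- The proximal points of `h(·, y)` exist, so that the oracle returns one of them. -/
lemma proxH_spec (hG : G.InClass p) (hO : O.Answer G) {γ : ℝ} (hγ : 0 < γ) {y : Vec n}
    (hy : y ∈ G.domPsi) (u : Vec m) :
    IsProxPoint G.X (fun x => G.h x y) γ u (O.proxH γ y u) := by
  refine hO.proxH_spec γ hγ y hy.1 u ?_
  have hc : ContinuousOn (fun x => (G.h x y).toReal + ‖x - u‖ ^ 2 / (2 * γ)) G.projDom := by
    have := hG.continuousOn_h.comp (f := fun x : Vec m => (x, y)) (by fun_prop)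
      (fun x hx => (⟨hx, hy⟩ : (x, y) ∈ G.projDom ×ˢ G.domPsi))
    exact this.add (by fun_prop)
  obtain ⟨q, hq, hmin⟩ := hG.compact_projDom.exists_isMinOn hG.nonempty_projDom hc
  refine ⟨q, ⟨hq.1, hG.h_lt_top hq hy.1⟩, fun x hx => ?_⟩
  by_cases hx' : x ∈ G.projDom
  · have := hmin hx'
    simp only [Set.mem_ofPred_eq] at this
    beta_reduce
    rw [← hG.coe_toReal_h hx' hy.1, ← hG.coe_toReal_h hq hy.1]
    exact_mod_cast this
  · have : G.h x y = ⊤ := by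
      by_contra hne
      exact hx' ⟨hx, y, hy.1, lt_of_le_of_ne le_top hne⟩
    beta_reduce
    rw [this, EReal.top_add_coe]
    exact le_top

lemma proxH_mem (hG : G.InClass p) (hO : O.Answer G) {γ : ℝ} (hγ : 0 < γ) {y : Vec n}
    (hy : y ∈ G.domPsi) (u : Vec m) : O.proxH γ y u ∈ G.projDom := by
  rw [← hG.effDom_h hy.1]
  exact (hG.proxH_spec hO hγ hy u).1

lemma proxH_variational (hG : G.InClass p) (hO : O.Answer G) {γ : ℝ} (hγ : 0 < γ) {y : Vec n}
    (hy : y ∈ G.domPsi) (u : Vec m) {w : Vec m} (hw : w ∈ G.projDom) :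
    (G.h (O.proxH γ y u) y).toReal - ⟪γ⁻¹ • (O.proxH γ y u - u), w - O.proxH γ y u⟫
      + p.μ / 2 * ‖w - O.proxH γ y u‖ ^ 2 ≤ (G.h w y).toReal := by
  have hmem := hG.proxH_mem hO hγ hy u
  refine (hG.strongConvexOn_h hy).prox_variational hmem (fun x hx => ?_) hw
  have := (hG.proxH_spec hO hγ hy u).2 x hx.1
  beta_reduce at this
  rw [← hG.coe_toReal_h hx hy.1, ← hG.coe_toReal_h hmem hy.1] at this
  exact_mod_cast this

open OracleAlgorithm

lemma initialPoint_mem (hG : G.InClass p) (hO : O.Answer G) :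
    (initialPoint O).1 ∈ G.projDom ∧ (initialPoint O).2 ∈ G.domPsi :=
  ⟨hG.proxH_mem hO one_pos (proxPsi_mem hO one_pos 0) 0, proxPsi_mem hO one_pos 0⟩

lemma smul_prox_residual {V : Type*} [AddCommGroup V] [Module ℝ V] {κ s : ℝ} (h : κ + s ≠ 0)
    (x c u b : V) :
    ((κ + s)⁻¹)⁻¹ • (x - (κ + s)⁻¹ • (κ • c + s • u - b)) = b + κ • (x - c) + s • (x - u) := by
  rw [inv_inv, smul_sub, smul_inv_smul₀ h]
  module

/-- With exact answers, the inner step of the algorithm is a primal-dual step. -/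
lemma innerStep_isPrimalDualStep (hG : G.InClass p) (hO : O.Answer G) {W : SlidingWeights}
    (hr : 0 < W.κ + W.r) (hs : 0 < W.κ + W.s) (a : PairVec m n) (xc : Vec m) (yc : Vec n)
    {z : (Vec m × Vec n) × (Vec m × Vec n)} (hx : z.1.1 ∈ G.projDom) (hy : z.1.2 ∈ G.domPsi)
    (hx₀ : z.2.1 ∈ G.projDom) (hy₀ : z.2.2 ∈ G.domPsi) :
    IsPrimalDualStep G.projDom G.domPsi (fun x y => (G.h x y).toReal) (fun y => (G.ψ y).toReal)
      G.gradH p.μ p.ν W.κ W.s W.r W.θ xc a.fst yc a.snd z.2.1 z.2.2 z.1.1 z.1.2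
      (innerStep O W a xc yc z).1.1 (innerStep O W a xc yc z).1.2 := by
  have hr' := inv_pos.2 hr
  have hs' := inv_pos.2 hs
  have hmem : (innerStep O W a xc yc z).1.2 ∈ G.domPsi := proxPsi_mem hO hr' _
  refine ⟨hG.proxH_mem hO hs' hmem _, hmem, fun w hw => ?_, fun w hw => ?_⟩
  · have h := hG.proxH_variational hO hs' hmem
      ((W.κ + W.s)⁻¹ • (W.κ • xc + W.s • z.1.1 - a.fst)) hw
    rwa [smul_prox_residual hs.ne'] at h
  · have h := hG.proxPsi_variational hO hr' ((W.κ + W.r)⁻¹ • (W.κ • yc + W.r • z.1.2 - (a.snd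
      - (O.gradH z.1.1 z.1.2 + W.θ • (O.gradH z.1.1 z.1.2 - O.gradH z.2.1 z.2.2))))) hw
    rw [smul_prox_residual hr.ne', ← sub_add, hO.gradH_eq _ hx _ hy.1, hO.gradH_eq _ hx₀ _ hy₀.1]
      at h
    have e : (innerStep O W a xc yc z).1.2 = O.proxPsi (W.κ + W.r)⁻¹
      ((W.κ + W.r)⁻¹ • (W.κ • yc + W.r • z.1.2 - a.snd
      + (G.gradH z.1.1 z.1.2 + W.θ • (G.gradH z.1.1 z.1.2 - G.gradH z.2.1 z.2.2)))) := by
      rw [← hO.gradH_eq _ hx _ hy.1, ← hO.gradH_eq _ hx₀ _ hy₀.1]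
      rfl
    rw [← e] at h
    convert h using 4
    abel

/-- One outer step contracts the distance to the equilibrium, provided that the inner method runs
long enough to reduce its initial energy below `m / 12` times the squared initial distance. -/
lemma outerStep_contraction (hG : G.InClass p) (hO : O.Answer G) {W : SlidingWeights}
    (hδ : 0 ≤ p.δ) (hμ : 0 < p.μ) (hν : 0 < p.ν) (hA : 0 ≤ min p.Lyx p.L)
    (hB : 0 ≤ min p.Lyy p.L) (hκ : W.κ = 4 * p.δ + min p.μ p.ν) {w : ℝ} (hw : 0 < w)
    (hs : W.s = min p.Lyx p.L * w) (hr : min p.Lyx p.L / w + 2 * min p.Lyy p.L ≤ W.r)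
    (hθ : 0 ≤ W.θ) (hθ1 : W.θ ≤ 1) (hsθ : W.s ≤ W.θ * (W.s + 2 * (W.κ + p.μ)))
    (hrθ : W.r ≤ W.θ * (W.r + 2 * (W.κ + p.ν))) {M : ℕ}
    (hM : ∀ x ∈ G.projDom, ∀ x' ∈ G.projDom, ∀ y ∈ G.domPsi, ∀ y' ∈ G.domPsi,
      W.θ ^ M * (W.s / 2 * ‖x - x'‖ ^ 2 + W.r / 2 * ‖y - y'‖ ^ 2)
        ≤ min p.μ p.ν / 12 * (‖x - x'‖ ^ 2 + ‖y - y'‖ ^ 2))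
    {xs : Vec m} {ys : Vec n}
    (hsol : IsSaddleSolution G.projDom G.domPsi (fun x y => (G.h x y).toReal)
      (fun y => (G.ψ y).toReal) p.μ p.ν xs ys (G.gradG (pairPt xs ys)).fst
      (G.gradG (pairPt xs ys)).snd)
    {z : Vec m × Vec n} (hx : z.1 ∈ G.projDom) (hy : z.2 ∈ G.domPsi) :
    (outerStep O W (M + 1) z).1 ∈ G.projDom ∧ (outerStep O W (M + 1) z).2 ∈ G.domPsi ∧
    (W.κ + min p.μ p.ν) * (‖(outerStep O W (M + 1) z).1 - xs‖ ^ 2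
        + ‖(outerStep O W (M + 1) z).2 - ys‖ ^ 2)
      ≤ W.κ * (‖z.1 - xs‖ ^ 2 + ‖z.2 - ys‖ ^ 2) := by
  have hmin : 0 < min p.μ p.ν := lt_min hμ hν
  have hκ0 : 0 < W.κ := by rw [hκ]; positivity
  have hs0 : 0 ≤ W.s := by rw [hs]; positivity
  have hr0 : 0 ≤ W.r := le_trans (by positivity) hr
  have hR := hG.isRegularSaddle
  set a := G.gradG (pairPt z.1 z.2) with ha
  obtain ⟨px, py, hp⟩ := hR.exists_regularized_solution hμ.le hν.le hκ0.le z.1 a.fst z.2 a.snd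
  let f := innerStep O W a z.1 z.2
  have hfmem : ∀ t, (f^[t] (z, z)).1.1 ∈ G.projDom ∧ (f^[t] (z, z)).1.2 ∈ G.domPsi ∧
      (f^[t] (z, z)).2.1 ∈ G.projDom ∧ (f^[t] (z, z)).2.2 ∈ G.domPsi := by
    intro t
    induction t with
    | zero => exact ⟨hx, hy, hx, hy⟩
    | succ t ih =>
      rw [Function.iterate_succ_apply']
      have := hG.innerStep_isPrimalDualStep hO (W := W) (by linarith) (by linarith) a z.1 z.2
        ih.1 ih.2.1 ih.2.2.1 ih.2.2.2
      exact ⟨this.mem_left, this.mem_right, ih.1, ih.2.1⟩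
  have hconv := hR.primalDual_convergence hA hB hμ.le hν.le hw hs hr hθ hθ1 hsθ hrθ hx hy hp
    (fun t => f^[t] (z, z)) rfl (fun t _ _ => by
      have := hG.innerStep_isPrimalDualStep hO (W := W) (by linarith) (by linarith) a z.1 z.2
        (hfmem t).1 (hfmem t).2.1 (hfmem t).2.2.1 (hfmem t).2.2.2
      simp only [Function.iterate_succ_apply']
      exact ⟨rfl, this⟩) M
  have hout : outerStep O W (M + 1) z = (f^[M + 1] (z, z)).1 := by
    unfold outerStep
    rw [hO.gradG_eq _ (mem_pairSet hx hy)]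
  rw [hout]
  refine ⟨hconv.1, hconv.2.1, ?_⟩
  refine hsol.inexact_forward_backward hδ hmin (min_le_left _ _) (min_le_right _ _) hκ hp ?_
    (hconv.2.2.trans (hM _ hx _ hp.1 _ hy _ hp.2.1))
  have := hG.inner_gradG_le (mem_pairSet hx hy) (mem_pairSet hp.1 hp.2.1)
    (mem_pairSet hsol.1 hsol.2.1)
  rwa [inner_pair_sub, norm_pair_sub_sq] at this

end CoupledGame.InClass

/-! ### Choice of the weights and complexity -/

/-- A geometric sequence of ratio at most `1 - 1 / c` falls below `1 / x` after `c * log x` terms. -/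
lemma pow_ceil_log_le {b c x : ℝ} (hb : 0 ≤ b) (hc : 0 < c) (hbc : b ≤ 1 - 1 / c) (hx : 0 < x) :
    b ^ ⌈c * Real.log x⌉₊ ≤ 1 / x := by
  have h1 : b ≤ Real.exp (-(1 / c)) := by
    have := Real.add_one_le_exp (-(1 / c))
    linarith
  calc b ^ ⌈c * Real.log x⌉₊ ≤ Real.exp (-(1 / c)) ^ ⌈c * Real.log x⌉₊ := by gcongr
    _ = Real.exp (-(⌈c * Real.log x⌉₊ / c)) := by
        rw [← Real.exp_nat_mul]; congr 1; ring
    _ ≤ Real.exp (-Real.log x) := by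
        refine Real.exp_le_exp.2 (neg_le_neg ?_)
        rw [le_div_iff₀ hc, mul_comm]
        exact Nat.le_ceil _
    _ = 1 / x := by rw [Real.exp_neg, Real.exp_log hx, one_div]

namespace GameParams

/-- The weight of the outer proximal term. -/
noncomputable def kappa (p : GameParams) : ℝ := 4 * p.δ + min p.μ p.ν

/-- The geometric mean of the moduli of the regularized saddle problem. -/
noncomputable def root (p : GameParams) : ℝ := √((p.kappa + p.μ) * (p.kappa + p.ν))

/-- The condition number of the regularized saddle problem. -/
noncomputable def cond (p : GameParams) : ℝ :=
  1 + 2 * (min p.Lyx p.L / p.root + min p.Lyy p.L / (p.kappa + p.ν))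

/-- The weights of the sliding algorithm. The ratio of `s` to `min Lyx L` balances the moduli
`κ + μ` and `κ + ν`. -/
noncomputable def weights (p : GameParams) : SlidingWeights where
  κ := p.kappa
  s := min p.Lyx p.L * ((p.kappa + p.μ) / p.root)
  r := 2 * (min p.Lyx p.L / ((p.kappa + p.μ) / p.root) + min p.Lyy p.L)
  θ := p.cond / (1 + p.cond)

/-- One less than the number of inner steps. The last step has no factor `θ`; the others reduce the
initial energy, whose weights are at most `2 L² / m`, to `m / 12` times the squared distance. -/
noncomputable def innerCount (p : GameParams) : ℕ :=
  ⌈(1 + p.cond) * Real.log (24 * (p.L / min p.μ p.ν) ^ 2)⌉₊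

/-- The number of outer steps. -/
noncomputable def outerCount (p : GameParams) (ε : ℝ) : ℕ :=
  ⌈(p.kappa + min p.μ p.ν) / min p.μ p.ν * Real.log (p.Dsq / ε)⌉₊

variable {p : GameParams}

/-- The sign conditions on the parameters. -/
structure Admissible (p : GameParams) : Prop where
  δ : 0 ≤ p.δ
  μ : 0 < p.μ
  ν : 0 < p.ν
  Lyx : 0 ≤ p.Lyx
  Lyy : 0 ≤ p.Lyy
  L : 0 ≤ p.L

namespace Admissible

lemma min_pos (h : p.Admissible) : 0 < min p.μ p.ν := lt_min h.μ h.ν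

lemma kappa_pos (h : p.Admissible) : 0 < p.kappa := by
  have := h.min_pos
  have := h.δ
  unfold kappa
  linarith

lemma le_kappa (h : p.Admissible) : p.δ ≤ p.kappa := by
  have := h.min_pos
  have := h.δ
  unfold kappa
  linarith

lemma root_pos (h : p.Admissible) : 0 < p.root :=
  Real.sqrt_pos.2 (mul_pos (add_pos h.kappa_pos h.μ) (add_pos h.kappa_pos h.ν))

lemma root_sq (h : p.Admissible) : p.root ^ 2 = (p.kappa + p.μ) * (p.kappa + p.ν) :=
  Real.sq_sqrt (mul_pos (add_pos h.kappa_pos h.μ) (add_pos h.kappa_pos h.ν)).le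

lemma min_Lyx_nonneg (h : p.Admissible) : 0 ≤ min p.Lyx p.L := le_min h.Lyx h.L

lemma min_Lyy_nonneg (h : p.Admissible) : 0 ≤ min p.Lyy p.L := le_min h.Lyy h.L

lemma one_le_cond (h : p.Admissible) : 1 ≤ p.cond := by
  have h1 := h.min_Lyx_nonneg
  have h2 := h.min_Lyy_nonneg
  have h3 := h.root_pos
  have h4 := add_pos h.kappa_pos h.ν
  have : 0 ≤ min p.Lyx p.L / p.root + min p.Lyy p.L / (p.kappa + p.ν) := by positivity
  unfold cond
  linarith

lemma cond_le (h : p.Admissible) :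
    1 + p.cond ≤ 2 * (1 + p.Lyx / √((p.δ + p.μ) * (p.δ + p.ν)) + p.Lyy / (p.δ + p.ν)) := by
  have h1 : 0 < p.δ + p.μ := add_pos_of_nonneg_of_pos h.δ h.μ
  have h2 : 0 < p.δ + p.ν := add_pos_of_nonneg_of_pos h.δ h.ν
  have h3 := h.le_kappa
  have h4 : min p.Lyx p.L / p.root ≤ p.Lyx / √((p.δ + p.μ) * (p.δ + p.ν)) := by
    refine div_le_div₀ h.Lyx (min_le_left _ _) (Real.sqrt_pos.2 (by positivity)) ?_
    have h0 : 0 ≤ p.kappa + p.μ := by linarith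
    exact Real.sqrt_le_sqrt (by gcongr)
  have h5 : min p.Lyy p.L / (p.kappa + p.ν) ≤ p.Lyy / (p.δ + p.ν) :=
    div_le_div₀ h.Lyy (min_le_left _ _) h2 (by gcongr)
  unfold cond
  linarith

lemma theta_nonneg (h : p.Admissible) : 0 ≤ p.weights.θ := by
  have := h.one_le_cond
  exact div_nonneg (by linarith) (by linarith)

lemma theta_eq (h : p.Admissible) : p.weights.θ = 1 - 1 / (1 + p.cond) := by
  have := h.one_le_cond
  have h' : 1 + p.cond ≠ 0 := by linarith
  change p.cond / (1 + p.cond) = _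
  field_simp
  ring

lemma theta_le_one (h : p.Admissible) : p.weights.θ ≤ 1 := by
  have := h.one_le_cond
  rw [h.theta_eq]
  have : 0 ≤ 1 / (1 + p.cond) := by positivity
  linarith

lemma le_theta_mul (h : p.Admissible) {t M : ℝ} (ht : t ≤ 2 * p.cond * M) :
    t ≤ p.weights.θ * (t + 2 * M) := by
  have := h.one_le_cond
  have h' : 0 < 1 + p.cond := by linarith
  change t ≤ p.cond / (1 + p.cond) * (t + 2 * M)
  rw [div_mul_eq_mul_div, le_div_iff₀ h']
  linarith

lemma ratio_pos (h : p.Admissible) : 0 < (p.kappa + p.μ) / p.root :=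
  div_pos (add_pos h.kappa_pos h.μ) h.root_pos

lemma inv_ratio (h : p.Admissible) :
    min p.Lyx p.L / ((p.kappa + p.μ) / p.root) = min p.Lyx p.L * ((p.kappa + p.ν) / p.root) := by
  have h1 := h.root_sq
  have h2 := h.root_pos
  have h3 := add_pos h.kappa_pos h.μ
  rw [div_div_eq_mul_div, mul_div_assoc]
  congr 1
  rw [div_eq_div_iff h3.ne' h2.ne', ← sq, h1]
  ring

lemma s_le (h : p.Admissible) : p.weights.s ≤ p.weights.θ * (p.weights.s + 2 * (p.kappa + p.μ)) := by
  refine h.le_theta_mul ?_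
  have h1 : 0 ≤ min p.Lyx p.L / p.root := div_nonneg h.min_Lyx_nonneg h.root_pos.le
  have h4 := add_pos h.kappa_pos h.ν
  have h2 : 0 ≤ min p.Lyy p.L / (p.kappa + p.ν) := div_nonneg h.min_Lyy_nonneg h4.le
  have h3 := add_pos h.kappa_pos h.μ
  have e : p.weights.s = min p.Lyx p.L / p.root * (p.kappa + p.μ) := by
    simp only [weights]; ring
  rw [e]
  refine mul_le_mul_of_nonneg_right ?_ h3.le
  unfold cond
  linarith

lemma r_le (h : p.Admissible) : p.weights.r ≤ p.weights.θ * (p.weights.r + 2 * (p.kappa + p.ν)) := by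
  refine h.le_theta_mul ?_
  have h1 : 0 ≤ min p.Lyx p.L / p.root := div_nonneg h.min_Lyx_nonneg h.root_pos.le
  have h4 := add_pos h.kappa_pos h.ν
  have h2 : 0 ≤ min p.Lyy p.L / (p.kappa + p.ν) := div_nonneg h.min_Lyy_nonneg h4.le
  have e : p.weights.r = 2 * (min p.Lyx p.L / p.root + min p.Lyy p.L / (p.kappa + p.ν))
      * (p.kappa + p.ν) := by
    simp only [weights, h.inv_ratio]; field_simp
  rw [e]
  refine mul_le_mul_of_nonneg_right ?_ h4.le
  unfold cond
  linarith

lemma ratio_le {κ μ ν L m R : ℝ} (hκ : 0 < κ) (hm : 0 < m) (hμ : m ≤ μ) (hν : m ≤ ν) (hμL : μ ≤ L)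
    (hR : 0 < R) (hR2 : R ^ 2 = (κ + μ) * (κ + ν)) : (κ + μ) / R ≤ L / m := by
  have hL : 1 ≤ L / m := (one_le_div hm).2 (hμ.trans hμL)
  have hLm : L / m * m = L := div_mul_cancel₀ L hm.ne'
  rw [div_le_iff₀ hR]
  refine le_of_sq_le_sq ?_ (by positivity)
  have h1 : κ + μ ≤ L / m * (κ + ν) := by
    have h2 : L / m * m ≤ L / m * ν := by gcongr
    have h3 : 1 * κ ≤ L / m * κ := by gcongr
    linarith
  have h4 : L / m * (κ + ν) ≤ (L / m) ^ 2 * (κ + ν) := by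
    refine mul_le_mul_of_nonneg_right ?_ (by linarith)
    nlinarith
  rw [mul_pow, hR2]
  have h5 : 0 ≤ κ + μ := by linarith
  nlinarith [mul_le_mul_of_nonneg_left (h1.trans h4) h5]

end Admissible

end GameParams

namespace CoupledGame.InClass

open GameParams OracleAlgorithm

variable {m n : ℕ} {G : CoupledGame m n} {p : GameParams} {O : Oracles m n}

/-- The initial energy of the inner method. If a modulus exceeds `L`, the corresponding domain is
a point and the term vanishes; otherwise its weight is bounded in terms of `L` and the smaller
modulus. -/
lemma initial_energy_le (hG : G.InClass p) (hp : p.Admissible) (hL : min p.μ p.ν ≤ p.L)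
    {x x' : Vec m} {y y' : Vec n} (hx : x ∈ G.projDom) (hx' : x' ∈ G.projDom) (hy : y ∈ G.domPsi)
    (hy' : y' ∈ G.domPsi) :
    p.weights.s / 2 * ‖x - x'‖ ^ 2 + p.weights.r / 2 * ‖y - y'‖ ^ 2
      ≤ 2 * (p.L / min p.μ p.ν) ^ 2 * min p.μ p.ν * (‖x - x'‖ ^ 2 + ‖y - y'‖ ^ 2) := by
  have hm := hp.min_pos
  have hκ := hp.kappa_pos
  have hq1 : 1 ≤ p.L / min p.μ p.ν := (one_le_div hm).2 hL
  have hqm : p.L / min p.μ p.ν * min p.μ p.ν = p.L := div_mul_cancel₀ _ hm.ne'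
  set q := p.L / min p.μ p.ν with hq
  have hL0 := hp.L
  have hqL : p.L * q = q ^ 2 * min p.μ p.ν := by rw [← hqm]; ring
  have hLq : p.L ≤ p.L * q := le_mul_of_one_le_right hL0 hq1
  have hA : min p.Lyx p.L ≤ p.L := min_le_right _ _
  have hB : min p.Lyy p.L ≤ p.L := min_le_right _ _
  have h1 : p.weights.s / 2 * ‖x - x'‖ ^ 2 ≤ 2 * q ^ 2 * min p.μ p.ν * ‖x - x'‖ ^ 2 := by
    rcases le_or_gt p.μ p.L with hμ | hμ
    · refine mul_le_mul_of_nonneg_right ?_ (sq_nonneg _)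
      have h2 := Admissible.ratio_le hκ hm (min_le_left _ _) (min_le_right _ _) hμ hp.root_pos
        hp.root_sq
      have h3 : p.weights.s ≤ p.L * q :=
        mul_le_mul hA h2 hp.ratio_pos.le hL0
      linarith
    · rw [hG.projDom_subsingleton hμ hx hx']
      simp
  have h2 : p.weights.r / 2 * ‖y - y'‖ ^ 2 ≤ 2 * q ^ 2 * min p.μ p.ν * ‖y - y'‖ ^ 2 := by
    rcases le_or_gt p.ν p.L with hν | hν
    · refine mul_le_mul_of_nonneg_right ?_ (sq_nonneg _)
      have h2 := Admissible.ratio_le hκ hm (min_le_right p.μ p.ν) (min_le_left _ _) hν hp.root_pos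
        (by rw [hp.root_sq]; ring)
      have h3 : min p.Lyx p.L * ((p.kappa + p.ν) / p.root) ≤ p.L * q :=
        mul_le_mul hA h2 (div_nonneg (add_pos hκ hp.ν).le hp.root_pos.le) hL0
      have h4 : p.weights.r = 2 * (min p.Lyx p.L * ((p.kappa + p.ν) / p.root) + min p.Lyy p.L) := by
        simp only [weights, hp.inv_ratio]
      rw [h4]
      linarith
    · rw [hG.domPsi_subsingleton hν hy hy']
      simp
  linarith

lemma theta_pow_mul_le (hG : G.InClass p) (hp : p.Admissible) (hL : min p.μ p.ν ≤ p.L)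
    {x x' : Vec m} {y y' : Vec n} (hx : x ∈ G.projDom) (hx' : x' ∈ G.projDom) (hy : y ∈ G.domPsi)
    (hy' : y' ∈ G.domPsi) :
    p.weights.θ ^ p.innerCount * (p.weights.s / 2 * ‖x - x'‖ ^ 2 + p.weights.r / 2 * ‖y - y'‖ ^ 2)
      ≤ min p.μ p.ν / 12 * (‖x - x'‖ ^ 2 + ‖y - y'‖ ^ 2) := by
  have hm := hp.min_pos
  have hL0 : 0 < p.L := hm.trans_le hL
  have h1 := hG.initial_energy_le hp hL hx hx' hy hy'
  have hc := hp.one_le_cond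
  have h2 := pow_ceil_log_le hp.theta_nonneg (by linarith : 0 < 1 + p.cond) hp.theta_eq.le
    (by positivity : 0 < 24 * (p.L / min p.μ p.ν) ^ 2)
  calc _ ≤ p.weights.θ ^ p.innerCount * (2 * (p.L / min p.μ p.ν) ^ 2 * min p.μ p.ν
        * (‖x - x'‖ ^ 2 + ‖y - y'‖ ^ 2)) :=
        mul_le_mul_of_nonneg_left h1 (pow_nonneg hp.theta_nonneg _)
    _ ≤ 1 / (24 * (p.L / min p.μ p.ν) ^ 2) * (2 * (p.L / min p.μ p.ν) ^ 2 * min p.μ p.ν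
        * (‖x - x'‖ ^ 2 + ‖y - y'‖ ^ 2)) :=
        mul_le_mul_of_nonneg_right h2 (by positivity)
    _ = _ := by field_simp; ring

/-- The outer iteration converges linearly to every equilibrium. -/
lemma outerStep_iterate (hG : G.InClass p) (hO : O.Answer G) (hp : p.Admissible)
    (hL : min p.μ p.ν ≤ p.L) {xs : Vec m} {ys : Vec n}
    (hsol : IsSaddleSolution G.projDom G.domPsi (fun x y => (G.h x y).toReal)
      (fun y => (G.ψ y).toReal) p.μ p.ν xs ys (G.gradG (pairPt xs ys)).fst
      (G.gradG (pairPt xs ys)).snd)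
    {z : Vec m × Vec n} (hx : z.1 ∈ G.projDom) (hy : z.2 ∈ G.domPsi) (k : ℕ) :
    ((outerStep O p.weights (p.innerCount + 1))^[k] z).1 ∈ G.projDom ∧
    ((outerStep O p.weights (p.innerCount + 1))^[k] z).2 ∈ G.domPsi ∧
    ‖((outerStep O p.weights (p.innerCount + 1))^[k] z).1 - xs‖ ^ 2
        + ‖((outerStep O p.weights (p.innerCount + 1))^[k] z).2 - ys‖ ^ 2
      ≤ (p.kappa / (p.kappa + min p.μ p.ν)) ^ k * (‖z.1 - xs‖ ^ 2 + ‖z.2 - ys‖ ^ 2) := by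
  have hm := hp.min_pos
  have hκ := hp.kappa_pos
  induction k with
  | zero => exact ⟨hx, hy, by simp⟩
  | succ k ih =>
    rw [Function.iterate_succ_apply']
    have h1 : 0 ≤ min p.Lyx p.L / ((p.kappa + p.μ) / p.root) :=
      div_nonneg hp.min_Lyx_nonneg hp.ratio_pos.le
    obtain ⟨g1, g2, g3⟩ := hG.outerStep_contraction hO (W := p.weights) hp.δ hp.μ hp.ν
      hp.min_Lyx_nonneg hp.min_Lyy_nonneg rfl hp.ratio_pos rfl
      (by simp only [weights]; linarith) hp.theta_nonneg
      hp.theta_le_one hp.s_le hp.r_le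
      (fun x hx x' hx' y hy y' hy' => hG.theta_pow_mul_le hp hL hx hx' hy hy') hsol ih.1 ih.2.1
    rw [show p.weights.κ = p.kappa from rfl] at g3
    refine ⟨g1, g2, ?_⟩
    have hpos : 0 < p.kappa + min p.μ p.ν := by linarith
    have g4 := mul_le_mul_of_nonneg_left ih.2.2 hκ.le
    have g5 : (p.kappa + min p.μ p.ν) * (p.kappa / (p.kappa + min p.μ p.ν)) = p.kappa :=
      mul_div_cancel₀ _ hpos.ne'
    refine le_of_mul_le_mul_left ((g3.trans g4).trans (le_of_eq ?_)) hpos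
    rw [pow_succ (p.kappa / (p.kappa + min p.μ p.ν)) k]
    linear_combination -((p.kappa / (p.kappa + min p.μ p.ν)) ^ k
      * (‖z.1 - xs‖ ^ 2 + ‖z.2 - ys‖ ^ 2)) * g5

lemma norm_sub_sq_add_le (hG : G.InClass p) {x x' : Vec m} {y y' : Vec n} (hx : x ∈ G.X)
    (hx' : x' ∈ G.X) (hy : y ∈ G.Y) (hy' : y' ∈ G.Y) :
    ‖x - x'‖ ^ 2 + ‖y - y'‖ ^ 2 ≤ p.Dsq := by
  have h1 : ‖x - x'‖ ≤ p.DX := by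
    rw [← dist_eq_norm]
    exact (Metric.dist_le_diam_of_mem hG.compact_X.isBounded hx hx').trans hG.diam_X
  have h2 : ‖y - y'‖ ≤ p.DY := by
    rw [← dist_eq_norm]
    exact (Metric.dist_le_diam_of_mem hG.compact_Y.isBounded hy hy').trans hG.diam_Y
  unfold Dsq
  gcongr

lemma isAccurateNash_outerStep (hG : G.InClass p) (hO : O.Answer G) (hp : p.Admissible)
    (hL : min p.μ p.ν ≤ p.L) {ε : ℝ} (hε : 0 < ε) (hD : ε < p.Dsq) :
    G.IsAccurateNash ε
      ((outerStep O p.weights (p.innerCount + 1))^[p.outerCount ε] (initialPoint O)).1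
      ((outerStep O p.weights (p.innerCount + 1))^[p.outerCount ε] (initialPoint O)).2 := by
  obtain ⟨xs, ys, hsol⟩ := hG.exists_equilibrium hp.μ.le hp.ν.le
  obtain ⟨h0x, h0y⟩ := hG.initialPoint_mem hO
  obtain ⟨h1, h2, h3⟩ := hG.outerStep_iterate hO hp hL hsol h0x h0y (p.outerCount ε)
  refine ⟨h1.1, h2.1, xs, ys, hG.isNash_of_isSaddleSolution hp.μ.le hp.ν.le hsol, h3.trans ?_⟩
  have hm := hp.min_pos
  have hκ := hp.kappa_pos
  have hDpos : 0 < p.Dsq := hε.trans hD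
  have h4 := pow_ceil_log_le (b := p.kappa / (p.kappa + min p.μ p.ν))
    (c := (p.kappa + min p.μ p.ν) / min p.μ p.ν) (by positivity) (by positivity)
    (le_of_eq (by field_simp; ring)) (div_pos hDpos hε)
  calc _ ≤ 1 / (p.Dsq / ε) * p.Dsq :=
        mul_le_mul h4 (hG.norm_sub_sq_add_le h0x.1 hsol.1.1 h0y.1 hsol.2.1.1) (by positivity)
          (by positivity)
    _ = ε := by field_simp

/-- In the degenerate cases the feasible starting point is already accurate. -/
lemma isAccurateNash_initialPoint (hG : G.InClass p) (hO : O.Answer G) (hp : p.Admissible)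
    {ε : ℝ} (hε : 0 < ε) (h : p.L < min p.μ p.ν ∨ p.Dsq ≤ ε) :
    G.IsAccurateNash ε (initialPoint O).1 (initialPoint O).2 := by
  obtain ⟨xs, ys, hsol⟩ := hG.exists_equilibrium hp.μ.le hp.ν.le
  obtain ⟨h0x, h0y⟩ := hG.initialPoint_mem hO
  refine ⟨h0x.1, h0y.1, xs, ys, hG.isNash_of_isSaddleSolution hp.μ.le hp.ν.le hsol, ?_⟩
  rcases h with h | h
  · rw [hG.projDom_subsingleton (h.trans_le (min_le_left _ _)) h0x hsol.1,
      hG.domPsi_subsingleton (h.trans_le (min_le_right _ _)) h0y hsol.2.1]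
    simpa using hε.le
  · exact (hG.norm_sub_sq_add_le h0x.1 hsol.1.1 h0y.1 hsol.2.1.1).trans h

end CoupledGame.InClass

namespace GameParams.Admissible

variable {p : GameParams}

lemma innerCount_le (hp : p.Admissible) (hL : min p.μ p.ν ≤ p.L) {ε : ℝ} (hε : 0 < ε)
    (hD : ε < p.Dsq) :
    ((p.innerCount + 1 : ℕ) : ℝ) ≤ 16 *
      ((1 + p.Lyx / √((p.δ + p.μ) * (p.δ + p.ν)) + p.Lyy / (p.δ + p.ν))
        * max 1 (Real.log (p.L * p.Dsq / (min p.μ p.ν * ε)))) := by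
  have hm := hp.min_pos
  have hc := hp.one_le_cond
  have hL0 : 0 < p.L := hm.trans_le hL
  have hq1 : 1 ≤ p.L / min p.μ p.ν := (one_le_div hm).2 hL
  set ℓ := max 1 (Real.log (p.L * p.Dsq / (min p.μ p.ν * ε))) with hℓ
  have hℓ1 : 1 ≤ ℓ := le_max_left _ _
  have h1 : Real.log (p.L / min p.μ p.ν) ≤ ℓ := by
    refine le_trans (Real.log_le_log (by positivity) ?_) (le_max_right _ _)
    rw [mul_div_mul_comm]
    exact le_mul_of_one_le_right (by positivity) ((one_le_div hε).2 hD.le)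
  have h24 : Real.log 24 ≤ 4 := by
    rw [Real.log_le_iff_le_exp (by norm_num)]
    have h2 : (2.7 : ℝ) ^ 4 ≤ Real.exp 1 ^ 4 := by
      gcongr
      exact (by norm_num : (2.7 : ℝ) ≤ 2.7182818283).trans Real.exp_one_gt_d9.le
    rw [← Real.exp_nat_mul] at h2
    norm_num at h2
    linarith
  have h3 : Real.log (24 * (p.L / min p.μ p.ν) ^ 2) ≤ 6 * ℓ := by
    rw [Real.log_mul (by norm_num) (by positivity), Real.log_pow]
    push_cast
    linarith
  have h4 : 0 ≤ Real.log (24 * (p.L / min p.μ p.ν) ^ 2) := Real.log_nonneg (by nlinarith)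
  have h5 : (p.innerCount : ℝ) ≤ (1 + p.cond) * (6 * ℓ) + 1 := by
    refine (Nat.ceil_lt_add_one (by positivity)).le.trans ?_
    gcongr
  have h6 : 2 * 1 ≤ (1 + p.cond) * ℓ := mul_le_mul (by linarith) hℓ1 zero_le_one (by linarith)
  have h7 := mul_le_mul_of_nonneg_right hp.cond_le (by linarith : 0 ≤ ℓ)
  push_cast
  linarith

lemma outerCount_le (hp : p.Admissible) {ε : ℝ} (hε : 0 < ε) (hD : ε < p.Dsq) :
    (p.outerCount ε : ℝ) ≤ 5 * ((1 + p.δ / min p.μ p.ν) * max 1 (Real.log (p.Dsq / ε))) := by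
  have hm := hp.min_pos
  have hκ := hp.kappa_pos
  have hlog : 0 ≤ Real.log (p.Dsq / ε) := Real.log_nonneg ((one_le_div hε).2 hD.le)
  set ℓ := max 1 (Real.log (p.Dsq / ε)) with hℓ
  have hℓ1 : 1 ≤ ℓ := le_max_left _ _
  have hd : 0 ≤ p.δ / min p.μ p.ν := div_nonneg hp.δ hm.le
  have h1 : (p.kappa + min p.μ p.ν) / min p.μ p.ν ≤ 4 * (1 + p.δ / min p.μ p.ν) := by
    have : (p.kappa + min p.μ p.ν) / min p.μ p.ν = 4 * (p.δ / min p.μ p.ν) + 2 := by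
      unfold kappa; field_simp; ring
    linarith
  have h2 : (p.outerCount ε : ℝ) ≤ 4 * (1 + p.δ / min p.μ p.ν) * ℓ + 1 := by
    refine (Nat.ceil_lt_add_one (by positivity)).le.trans ?_
    gcongr
    exact le_max_right _ _
  have h3 : 1 * 1 ≤ (1 + p.δ / min p.μ p.ν) * ℓ :=
    mul_le_mul (by linarith) hℓ1 zero_le_one (by linarith)
  linarith

end GameParams.Admissible

open OracleAlgorithm in
theorem mainTheorem7 :
    ∃ C : ℝ, 0 < C ∧
      ∀ (m n : ℕ) (p : GameParams) (ε : ℝ),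
        0 ≤ p.δ → 0 < p.μ → 0 < p.ν → 0 ≤ p.Lyx → 0 ≤ p.Lyy → 0 ≤ p.L → 0 < ε →
        ∃ A : OracleAlgorithm m n,
          ∀ (G : CoupledGame m n) (O : Oracles m n), G.InClass p → O.Answer G →
            G.IsAccurateNash ε (A.output O).1 (A.output O).2 ∧
            (A.numOther O : ℝ) ≤
              C * ((1 + p.δ / min p.μ p.ν) *
                (1 + p.Lyx / Real.sqrt ((p.δ + p.μ) * (p.δ + p.ν)) + p.Lyy / (p.δ + p.ν)) *
                max 1 (Real.log (p.L * p.Dsq / (min p.μ p.ν * ε))) *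
                max 1 (Real.log (p.Dsq / ε))) ∧
            (A.numGradG O : ℝ) ≤
              C * ((1 + p.δ / min p.μ p.ν) * max 1 (Real.log (p.Dsq / ε))) := by
  -- `322 = 4 * 16 * 5 + 2`: four queries per inner step, the factors `16` and `5` of the two step
  -- counts, and two queries for the starting point.
  refine ⟨322, by norm_num, fun m n p ε hδ hμ hν hLyx hLyy hL0 hε => ?_⟩
  have hp : p.Admissible := ⟨hδ, hμ, hν, hLyx, hLyy, hL0⟩
  have hm := hp.min_pos
  set S := 1 + p.δ / min p.μ p.ν with hS
  set T := 1 + p.Lyx / √((p.δ + p.μ) * (p.δ + p.ν)) + p.Lyy / (p.δ + p.ν) with hT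
  set ℓ := max 1 (Real.log (p.L * p.Dsq / (min p.μ p.ν * ε))) with hℓ
  set ℓ' := max 1 (Real.log (p.Dsq / ε)) with hℓ'
  have hℓ1 : 1 ≤ ℓ := le_max_left _ _
  have hℓ1' : 1 ≤ ℓ' := le_max_left _ _
  have hS1 : 1 ≤ S := le_add_of_nonneg_right (div_nonneg hδ hm.le)
  have hT1 : 1 ≤ T := by
    have h1 : 0 ≤ p.Lyx / √((p.δ + p.μ) * (p.δ + p.ν)) := by positivity
    have h2 : 0 ≤ p.Lyy / (p.δ + p.ν) := by positivity
    linarith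
  have hprod : 1 ≤ S * T * ℓ * ℓ' :=
    one_le_mul_of_one_le_of_one_le (one_le_mul_of_one_le_of_one_le
      (one_le_mul_of_one_le_of_one_le hS1 hT1) hℓ1) hℓ1'
  by_cases hcase : p.L < min p.μ p.ν ∨ p.Dsq ≤ ε
  · refine ⟨startFeasible fun z => finish z.1 z.2, fun G O hG hO =>
      ⟨hG.isAccurateNash_initialPoint hO hp hε hcase, ?_, ?_⟩⟩
    · have : (startFeasible fun z : Vec m × Vec n => finish z.1 z.2).numOther O = 2 := rfl
      rw [this]
      push_cast
      linarith
    · have : (startFeasible fun z : Vec m × Vec n => finish z.1 z.2).numGradG O = 0 := rfl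
      rw [this]
      push_cast
      positivity
  · push Not at hcase
    obtain ⟨hL, hD⟩ := hcase
    refine ⟨startFeasible (outerLoop p.weights (p.innerCount + 1) (p.outerCount ε)),
      fun G O hG hO => ?_⟩
    obtain ⟨h1, h2, h3⟩ := outerLoop_run O p.weights (p.innerCount + 1) (p.outerCount ε)
      (initialPoint O)
    have hN := hp.innerCount_le hL hε hD
    have hK := hp.outerCount_le hε hD
    refine ⟨?_, ?_, ?_⟩
    · have : (startFeasible (outerLoop p.weights (p.innerCount + 1) (p.outerCount ε))).output O
          = _ := h1
      rw [this]
      exact hG.isAccurateNash_outerStep hO hp hL hε hD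
    · have : (startFeasible (outerLoop p.weights (p.innerCount + 1) (p.outerCount ε))).numOther O
          = 4 * (p.innerCount + 1) * p.outerCount ε + 1 + 1 := congrArg (· + 1 + 1) h2
      rw [this]
      have h4 := mul_le_mul hN hK (Nat.cast_nonneg _) (by positivity)
      push_cast at h4 ⊢
      linarith
    · have : (startFeasible (outerLoop p.weights (p.innerCount + 1) (p.outerCount ε))).numGradG O
          = p.outerCount ε := h3
      rw [this]
      have : 0 ≤ S * ℓ' := by positivity
      linarith
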